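/- Let $d\ge 1$ be an integer and let $T=(T_1,\ldots,T_d)$ be a $d$-tuple of bounded linear operators on a complex Hilbert space $\mathfrak H$. For a word $w=i_1\cdots i_s$ in the letters $1,\ldots,d$ put $T_w=T_{i_1}\cdots T_{i_s}$ (with $T_w=I$ for the empty word). Assume that * $T$ is a row contraction, that is, the operator $\mathfrak H^{(d)}\to\mathfrak H$, $(\xi_1,\ldots,\xi_d)\mapsto\sum_{k=1}^d T_k\xi_k$, has norm at most $1$, where $\mathfrak H^{(d)}$ is the Hilbert space direct sum of $d$ copies of $\mathfrak H$; * $T$ is pure, that is, $\lim_{n\to\infty}\sum_{|w|=n}\|T_w^*\xi\|^2=0$ for every $\xi\in\mathfrak H$; * $T$ is cyclic, that is, there is a vector $\xi\in\mathfrak H$ such that the closed linear span of all $T_w\xi$, over all words $w$, is $\mathfrak H$. Let $\mathfrak F^2_d=\mathbb C\,\Omega\oplus\bigoplus_{n\ge1}(\mathbb C^d)^{\otimes n}$ be the full Fock space over $\mathbb C^d$, and let $L_kv=e_k\otimes v$ be its left creation operators, where $e_1,\ldots,e_d$ is the standard orthonormal basis of $\mathbb C^d$. Then there is a bounded linear operator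 $X:\mathfrak F^2_d\to\mathfrak H$ with $\|X\|\le1$ and dense range such that $XL_k=T_kX$ for $k=1,\ldots,d$. Let $H^2_d$ be the Drury--Arveson space: the Hilbert space of analytic functions $f=\sum_{\alpha\in\mathbb N^d}c_\alpha x^\alpha$ on the open unit ball of $\mathbb C^d$ with $\|f\|^2=\sum_{\alpha}\frac{\alpha_1!\cdots\alpha_d!}{|\alpha|!}|c_\alpha|^2<\infty$, and let $M_{x_k}$ be multiplication by the $k$-th coordinate function on $H^2_d$. If, in addition, $T_1,\ldots,T_d$ commute with each other, then there is a bounded linear operator $X':H^2_d\to\mathfrak H$ with $\|X'\|\le1$ and dense range such that $X'M_{x_k}=T_kX'$ for $k=1,\ldots,d$. -/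

import Mathlib

open scoped TensorProduct Nat InnerProductSpace

noncomputable section

namespace RowShift

/-! ### Tuples of operators -/

section Tuples

variable {d : ℕ} {H : Type*} [NormedAddCommGroup H] [InnerProductSpace ℂ H]

/-- The row operator `[T₁, …, T_d] : H^(d) → H`, `ξ ↦ ∑ k, T_k ξ_k`, where `H^(d)` is the Hilbert
space direct sum of `d` copies of `H`. -/
def rowOperator (T : Fin d → H →L[ℂ] H) : PiLp 2 (fun _ : Fin d => H) →L[ℂ] H :=
  ∑ k, (T k).comp (PiLp.proj 2 (fun _ : Fin d => H) k)

/-- `T` is a row contraction: its row operator is contractive. -/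
def IsRowContraction (T : Fin d → H →L[ℂ] H) : Prop :=
  ‖rowOperator T‖ ≤ 1

/-- `T_w = T_{i₁} T_{i₂} ⋯ T_{i_s}` for a word `w = i₁ i₂ … i_s` (the identity for the empty
word). -/
def wordOp (T : Fin d → H →L[ℂ] H) (w : List (Fin d)) : H →L[ℂ] H :=
  (w.map T).prod

/-- `T` is pure: `∑_{|w| = n} ‖T_w^* ξ‖² → 0` for every `ξ`. -/
def IsPure [CompleteSpace H] (T : Fin d → H →L[ℂ] H) : Prop :=
  ∀ ξ : H, Filter.Tendsto
    (fun n : ℕ => ∑ w : Fin n → Fin d,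
      ‖(ContinuousLinearMap.adjoint (wordOp T (List.ofFn w))) ξ‖ ^ 2)
    Filter.atTop (nhds 0)

/-- `Γ` is a cyclic set for `T`: the closed linear span of all `T_w γ` is the whole space. -/
def IsCyclicSet (T : Fin d → H →L[ℂ] H) (Γ : Set H) : Prop :=
  (Submodule.span ℂ {x : H | ∃ w : List (Fin d), ∃ γ ∈ Γ, x = wordOp T w γ}).topologicalClosure = ⊤

/-- `T` is cyclic: it admits a cyclic vector. -/
def IsCyclic (T : Fin d → H →L[ℂ] H) : Prop :=
  ∃ ξ : H, IsCyclicSet T {ξ}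

end Tuples

/-! ### The full Fock space -/

/-- A complex inner product space together with its structure. -/
structure InnerSpace where
  /-- the underlying type -/
  carrier : Type
  [group : NormedAddCommGroup carrier]
  [inner : InnerProductSpace ℂ carrier]

attribute [instance] InnerSpace.group InnerSpace.inner

/-- The tensor powers `(ℂ^d)^{⊗ n}`: the scalars for `n = 0`, and
`ℂ^d ⊗ (ℂ^d)^{⊗ n}` for `n + 1`. -/
def tensorPowerAux (d : ℕ) : ℕ → InnerSpace
  | 0 => ⟨ℂ⟩
  | n + 1 => ⟨EuclideanSpace ℂ (Fin d) ⊗[ℂ] (tensorPowerAux d n).carrier⟩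

/-- The Hilbert space `(ℂ^d)^{⊗ n}`. -/
abbrev TensorPow (d n : ℕ) : Type := (tensorPowerAux d n).carrier

instance tensorPow_finiteDimensional (d n : ℕ) : FiniteDimensional ℂ (TensorPow d n) := by
  induction n with
  | zero => exact inferInstanceAs (FiniteDimensional ℂ ℂ)
  | succ n ih =>
    exact inferInstanceAs
      (FiniteDimensional ℂ (EuclideanSpace ℂ (Fin d) ⊗[ℂ] TensorPow d n))

instance tensorPow_complete (d n : ℕ) : CompleteSpace (TensorPow d n) :=
  FiniteDimensional.complete ℂ _

/-- The isometry `v ↦ e_k ⊗ v` from `(ℂ^d)^{⊗ n}` to `(ℂ^d)^{⊗ (n+1)}`, with `e_k` the `k`-th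
vector of the standard orthonormal basis of `ℂ^d`. -/
def tensorLeft {d : ℕ} (k : Fin d) (n : ℕ) : TensorPow d n →ₗ[ℂ] TensorPow d (n + 1) :=
  TensorProduct.mk ℂ (EuclideanSpace ℂ (Fin d)) (TensorPow d n) (EuclideanSpace.single k 1)

lemma norm_tensorLeft {d : ℕ} (k : Fin d) (n : ℕ) (v : TensorPow d n) :
    ‖tensorLeft k n v‖ = ‖v‖ := by
  refine (TensorProduct.norm_tmul (𝕜 := ℂ) (EuclideanSpace.single k (1 : ℂ)) v).trans ?_
  rw [PiLp.norm_single, norm_one, one_mul]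

/-- The full Fock space `ℂΩ ⊕ ⨁_{n ≥ 1} (ℂ^d)^{⊗ n}` (Hilbert space direct sum). -/
abbrev FullFock (d : ℕ) : Type := lp (fun n : ℕ => TensorPow d n) 2

/-- `e_k ⊗ v` for `v` in the full Fock space, as a sequence of its homogeneous components. -/
def creationFun {d : ℕ} (k : Fin d) (v : ∀ n, TensorPow d n) : ∀ n, TensorPow d n
  | 0 => 0
  | n + 1 => tensorLeft k n (v n)

lemma hasSum_creationFun {d : ℕ} (k : Fin d) (v : FullFock d) :
    HasSum (fun n => ‖creationFun k v n‖ ^ (2 : ENNReal).toReal)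
      (‖v‖ ^ (2 : ENNReal).toReal) := by
  have h := lp.hasSum_norm (p := 2) (by norm_num) v
  rw [← hasSum_nat_add_iff' 1]
  simpa [creationFun, norm_tensorLeft] using h

/-- The left creation operator `L_k v = e_k ⊗ v`, as an isometry of the full Fock space. -/
def creationIsometry {d : ℕ} (k : Fin d) : FullFock d →ₗᵢ[ℂ] FullFock d where
  toFun v := ⟨creationFun k v, memℓp_gen (hasSum_creationFun k v).summable⟩
  map_add' u v := by
    ext n
    cases n with
    | zero => exact (add_zero (0 : TensorPow d 0)).symm
    | succ n => exact map_add (tensorLeft k n) (u n) (v n)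
  map_smul' c v := by
    ext n
    cases n with
    | zero => exact (smul_zero (M := ℂ) (A := TensorPow d 0) c).symm
    | succ n => exact map_smul (tensorLeft k n) c (v n)
  norm_map' v := by
    have h := (lp.hasSum_norm (p := 2) (by norm_num)
      (⟨creationFun k v, memℓp_gen (hasSum_creationFun k v).summable⟩ : FullFock d)).unique
      (hasSum_creationFun k v)
    simpa using h

/-- The left creation operator `L_k` on the full Fock space. -/
def creation {d : ℕ} (k : Fin d) : FullFock d →L[ℂ] FullFock d :=
  (creationIsometry k).toContinuousLinearMap

/-! ### The Drury–Arveson space -/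

/-- The open unit ball of `ℂ^d`. -/
abbrev UnitBall (d : ℕ) : Type := Metric.ball (0 : EuclideanSpace ℂ (Fin d)) 1

/-- The monomial `z^α = z₁^{α₁} ⋯ z_d^{α_d}`. -/
def monom {d : ℕ} (α : Fin d → ℕ) (z : EuclideanSpace ℂ (Fin d)) : ℂ := ∏ i, z i ^ α i

/-- The weight `α! / |α|!`. -/
def weight {d : ℕ} (α : Fin d → ℕ) : ℝ := ((∏ i, (α i)! : ℕ) : ℝ) / ((∑ i, α i)! : ℕ)

/-- `c` is a family of power series coefficients of `f` on the ball, with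
`∑ α! / |α|! * |c_α|² < ∞`. -/
def IsCoeff {d : ℕ} (f : UnitBall d → ℂ) (c : (Fin d → ℕ) → ℂ) : Prop :=
  Summable (fun α => weight α * ‖c α‖ ^ 2) ∧
    ∀ z : UnitBall d, HasSum (fun α => c α * monom α (z : EuclideanSpace ℂ (Fin d))) (f z)

lemma weight_pos {d : ℕ} (α : Fin d → ℕ) : 0 < weight α := by
  unfold weight
  have h1 : 0 < ∏ i, (α i)! := Finset.prod_pos fun i _ => Nat.factorial_pos _
  have h2 : 0 < (∑ i, α i)! := Nat.factorial_pos _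
  positivity

lemma IsCoeff.add {d : ℕ} {f g : UnitBall d → ℂ} {a b : (Fin d → ℕ) → ℂ}
    (hf : IsCoeff f a) (hg : IsCoeff g b) : IsCoeff (f + g) (a + b) := by
  refine ⟨?_, fun z => ?_⟩
  · refine Summable.of_nonneg_of_le (fun α => ?_) (fun α => ?_)
      ((hf.1.mul_left 2).add (hg.1.mul_left 2))
    · have := weight_pos α
      positivity
    · have h1 : ‖(a + b) α‖ ^ 2 ≤ 2 * ‖a α‖ ^ 2 + 2 * ‖b α‖ ^ 2 := by
        have h2 : ‖(a + b) α‖ ≤ ‖a α‖ + ‖b α‖ := norm_add_le _ _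
        have h3 : ‖(a + b) α‖ ^ 2 ≤ (‖a α‖ + ‖b α‖) ^ 2 := by gcongr
        nlinarith [sq_nonneg (‖a α‖ - ‖b α‖)]
      have := mul_le_mul_of_nonneg_left h1 (weight_pos α).le
      linarith
  · simpa [add_mul] using (hf.2 z).add (hg.2 z)

lemma IsCoeff.smul {d : ℕ} {f : UnitBall d → ℂ} {a : (Fin d → ℕ) → ℂ}
    (r : ℂ) (hf : IsCoeff f a) : IsCoeff (r • f) (r • a) := by
  refine ⟨?_, fun z => ?_⟩
  · refine (hf.1.mul_left (‖r‖ ^ 2)).congr fun α => ?_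
    rw [Pi.smul_apply, norm_smul]
    ring
  · simpa [mul_assoc] using (hf.2 z).mul_left r

lemma isCoeff_zero {d : ℕ} : IsCoeff (0 : UnitBall d → ℂ) 0 :=
  ⟨by simp, fun z => by simp⟩

/-- The functions on the unit ball that belong to the Drury–Arveson space. -/
def druryArvesonSubmodule (d : ℕ) : Submodule ℂ (UnitBall d → ℂ) where
  carrier := {f | ∃ c, IsCoeff f c}
  add_mem' := by
    rintro f g ⟨a, ha⟩ ⟨b, hb⟩
    exact ⟨_, ha.add hb⟩
  zero_mem' := ⟨0, isCoeff_zero⟩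
  smul_mem' := by
    rintro r f ⟨a, ha⟩
    exact ⟨_, ha.smul r⟩

/-- The Drury–Arveson space `H²_d`: all functions on the unit ball of `ℂ^d` with a power series
`∑ c_α x^α` such that `∑ α! / |α|! * |c_α|² < ∞`. -/
def DruryArveson (d : ℕ) : Type := druryArvesonSubmodule d

namespace DruryArveson

variable {d : ℕ}

instance : AddCommGroup (DruryArveson d) := inferInstanceAs (AddCommGroup (druryArvesonSubmodule d))
instance : Module ℂ (DruryArveson d) := inferInstanceAs (Module ℂ (druryArvesonSubmodule d))

/-- The function on the ball underlying an element of `H²_d`. -/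
def eval (f : DruryArveson d) : UnitBall d → ℂ := f.1

lemma eval_add (f g : DruryArveson d) : (f + g).eval = f.eval + g.eval := rfl

lemma eval_smul (r : ℂ) (f : DruryArveson d) : (r • f).eval = r • f.eval := rfl

lemma eval_injective : Function.Injective (eval : DruryArveson d → UnitBall d → ℂ) :=
  Subtype.val_injective

/-- The power series coefficients `c_α` of an element of `H²_d`. -/
def coeff (f : DruryArveson d) : (Fin d → ℕ) → ℂ := Classical.choose f.2

lemma isCoeff_coeff (f : DruryArveson d) : IsCoeff f.eval f.coeff := Classical.choose_spec f.2

end DruryArveson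

/-- Uniqueness of power series coefficients on the ball. -/
lemma coeff_eq_zero {d : ℕ} {c : (Fin d → ℕ) → ℂ}
    (h : ∀ z : UnitBall d, HasSum (fun α => c α * monom α (z : EuclideanSpace ℂ (Fin d))) 0) :
    c = 0 := by
  classical
  -- homogeneous components vanish on the ball
  have key : ∀ (n : ℕ) (z : UnitBall d),
      ∑ α ∈ Finset.piAntidiag Finset.univ n, c α * monom α (z : EuclideanSpace ℂ (Fin d)) = 0 := by
    intro n z
    set p : ℕ → ℂ := fun n =>
      ∑ α ∈ Finset.piAntidiag Finset.univ n, c α * monom α (z : EuclideanSpace ℂ (Fin d)) with hp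
    have hz : ‖(z : EuclideanSpace ℂ (Fin d))‖ < 1 := mem_ball_zero_iff.1 z.2
    have h1 : ∀ t : ℂ, ‖t‖ < 1 → HasSum (fun n => t ^ n * p n) 0 := by
      intro t ht
      have hmem : t • (z : EuclideanSpace ℂ (Fin d)) ∈
          Metric.ball (0 : EuclideanSpace ℂ (Fin d)) 1 := by
        rw [mem_ball_zero_iff, norm_smul]
        nlinarith [norm_nonneg t, norm_nonneg (z : EuclideanSpace ℂ (Fin d))]
      have h2 := h ⟨_, hmem⟩
      rw [← (Equiv.sigmaFiberEquiv (fun α : Fin d → ℕ => ∑ i, α i)).hasSum_iff] at h2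
      refine h2.sigma fun n => ?_
      have e : ∀ α : Fin d → ℕ, α ∈ Finset.piAntidiag Finset.univ n ↔ ∑ i, α i = n := by
        intro α
        simp
      have h3 := (Equiv.subtypeEquivRight e).hasSum_iff
        (f := fun α : {α : Fin d → ℕ // ∑ i, α i = n} =>
          c α * monom α (t • (z : EuclideanSpace ℂ (Fin d)))) (a := t ^ n * p n)
      refine h3.1 ?_
      have h4 := Finset.hasSum (Finset.piAntidiag (Finset.univ : Finset (Fin d)) n)
        (fun α => c α * monom α (t • (z : EuclideanSpace ℂ (Fin d))))
      have h4' : ∑ α ∈ Finset.piAntidiag (Finset.univ : Finset (Fin d)) n,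
          c α * monom α (t • (z : EuclideanSpace ℂ (Fin d))) = t ^ n * p n := by
        rw [hp, Finset.mul_sum]
        refine Finset.sum_congr rfl fun α hα => ?_
        have : monom α (t • (z : EuclideanSpace ℂ (Fin d))) =
            t ^ n * monom α (z : EuclideanSpace ℂ (Fin d)) := by
          simp only [monom, PiLp.smul_apply, smul_eq_mul, mul_pow, Finset.prod_mul_distrib]
          rw [Finset.prod_pow_eq_pow_sum, (e α).1 hα]
        rw [this]
        ring
      rw [h4'] at h4
      exact h4
    have h5 : HasFPowerSeriesAt (fun _ : ℂ => (0 : ℂ)) (FormalMultilinearSeries.ofScalars ℂ p) 0 := by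
      rw [hasFPowerSeriesAt_iff]
      filter_upwards [Metric.ball_mem_nhds (0 : ℂ) one_pos] with t ht
      have := h1 t (by simpa using ht)
      simpa [FormalMultilinearSeries.coeff_ofScalars] using this
    have h6 := h5.eq_zero
    have h7 : (FormalMultilinearSeries.ofScalars ℂ p : FormalMultilinearSeries ℂ ℂ ℂ).coeff n = 0 := by
      rw [h6]
      rfl
    simpa [FormalMultilinearSeries.coeff_ofScalars] using h7
  -- hence everywhere
  funext α
  set n := ∑ i, α i with hn
  let P : MvPolynomial (Fin d) ℂ :=
    ∑ β ∈ Finset.piAntidiag Finset.univ n, MvPolynomial.monomial (Finsupp.equivFunOnFinite.symm β) (c β)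
  have hP : P = 0 := by
    refine MvPolynomial.funext fun x => ?_
    let y : EuclideanSpace ℂ (Fin d) := WithLp.toLp 2 x
    let r : ℝ := (‖y‖ + 1)⁻¹
    have hr : 0 < r := by positivity
    have hmem : (r : ℂ) • y ∈ Metric.ball (0 : EuclideanSpace ℂ (Fin d)) 1 := by
      rw [mem_ball_zero_iff, norm_smul, Complex.norm_real, Real.norm_of_nonneg hr.le]
      simp only [r]
      rw [inv_mul_lt_iff₀ (by positivity)]
      linarith
    have h8 := key n ⟨_, hmem⟩
    have h9 : ∑ β ∈ Finset.piAntidiag Finset.univ n, c β * monom β ((r : ℂ) • y) =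
        (r : ℂ) ^ n * MvPolynomial.eval x P := by
      simp only [P, map_sum, Finset.mul_sum]
      refine Finset.sum_congr rfl fun β hβ => ?_
      have hβ' : ∑ i, β i = n := by simpa using hβ
      rw [MvPolynomial.eval_monomial, Finsupp.prod_fintype _ _ (by simp)]
      simp only [monom, PiLp.smul_apply, smul_eq_mul, mul_pow, Finset.prod_mul_distrib, y,
        Finsupp.equivFunOnFinite_symm_apply_apply]
      rw [Finset.prod_pow_eq_pow_sum, hβ']
      ring
    simp only at h8
    rw [h9] at h8
    have : (r : ℂ) ^ n ≠ 0 := pow_ne_zero _ (by exact_mod_cast hr.ne')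
    simpa [this] using h8
  have h10 : MvPolynomial.coeff (Finsupp.equivFunOnFinite.symm α) P = c α := by
    simp only [P, MvPolynomial.coeff_sum, MvPolynomial.coeff_monomial,
      EmbeddingLike.apply_eq_iff_eq]
    simp [hn]
  rw [← h10, hP]
  simp

lemma IsCoeff.unique {d : ℕ} {f : UnitBall d → ℂ} {a b : (Fin d → ℕ) → ℂ}
    (ha : IsCoeff f a) (hb : IsCoeff f b) : a = b := by
  have : a - b = 0 := coeff_eq_zero fun z => by
    simpa [sub_mul] using (ha.2 z).sub (hb.2 z)
  exact sub_eq_zero.1 this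

/-- Square-summable weighted coefficients define a convergent power series on the ball. -/
lemma summable_of_weighted {d : ℕ} {c : (Fin d → ℕ) → ℂ}
    (hc : Summable (fun α => weight α * ‖c α‖ ^ 2)) (z : UnitBall d) :
    Summable (fun α => c α * monom α (z : EuclideanSpace ℂ (Fin d))) := by
  classical
  have hz : ‖(z : EuclideanSpace ℂ (Fin d))‖ < 1 := mem_ball_zero_iff.1 z.2
  have h1 : Summable (fun α : Fin d → ℕ =>
      (weight α)⁻¹ * ‖monom α (z : EuclideanSpace ℂ (Fin d))‖ ^ 2) := by
    set s : ℝ := ‖(z : EuclideanSpace ℂ (Fin d))‖ ^ 2 with hs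
    have hs1 : s < 1 := by
      rw [hs]
      nlinarith [norm_nonneg (z : EuclideanSpace ℂ (Fin d))]
    have hs0 : 0 ≤ s := by positivity
    have hpow : ∀ n : ℕ, ∑ α ∈ Finset.piAntidiag (Finset.univ : Finset (Fin d)) n,
        (weight α)⁻¹ * ‖monom α (z : EuclideanSpace ℂ (Fin d))‖ ^ 2 = s ^ n := by
      intro n
      rw [hs, EuclideanSpace.norm_sq_eq, Finset.sum_pow_eq_sum_piAntidiag]
      refine Finset.sum_congr rfl fun α _ => ?_
      have h2 : (weight α)⁻¹ = (Nat.multinomial Finset.univ α : ℝ) := by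
        have h3 := Nat.multinomial_spec (Finset.univ : Finset (Fin d)) α
        have h4 : 0 < ∏ i, (α i)! := Finset.prod_pos fun i _ => Nat.factorial_pos _
        have h5 : ((∏ i, (α i)! : ℕ) : ℝ) ≠ 0 := by exact_mod_cast h4.ne'
        rw [weight, inv_div, ← h3]
        rw [Nat.cast_mul]
        field_simp
      rw [h2]
      simp only [monom, norm_prod, norm_pow, ← Finset.prod_pow]
      congr 1
      refine Finset.prod_congr rfl fun i _ => ?_
      ring
    refine summable_of_sum_le (c := (1 - s)⁻¹) (fun α => ?_) (fun u => ?_)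
    · have := weight_pos α
      positivity
    · let N := u.sup (fun α => ∑ i, α i) + 1
      have hsub : u ⊆ (Finset.range N).biUnion
          (fun n => Finset.piAntidiag (Finset.univ : Finset (Fin d)) n) := by
        intro α hα
        simp only [Finset.mem_biUnion, Finset.mem_range, Finset.mem_piAntidiag]
        refine ⟨∑ i, α i, ?_, rfl, by simp⟩
        have := Finset.le_sup (f := fun α : Fin d → ℕ => ∑ i, α i) hα
        simp only [N]
        omega
      refine (Finset.sum_le_sum_of_subset_of_nonneg hsub fun α _ _ => ?_).trans ?_
      · have := weight_pos α
        positivity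
      · rw [Finset.sum_biUnion]
        · simp only [hpow]
          rw [← tsum_geometric_of_lt_one hs0 hs1]
          exact (summable_geometric_of_lt_one hs0 hs1).sum_le_tsum _ (fun i _ => by positivity)
        · intro m _ n _ hmn
          rw [Function.onFun, Finset.disjoint_left]
          intro α h2 h3
          simp only [Finset.mem_piAntidiag] at h2 h3
          exact hmn (h2.1.symm.trans h3.1)
  refine Summable.of_norm_bounded (hc.add h1) fun α => ?_
  rw [norm_mul]
  have hw := weight_pos α
  have h2 : weight α * (weight α)⁻¹ = 1 := mul_inv_cancel₀ hw.ne'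
  have h3 : 0 ≤ (weight α)⁻¹ := by positivity
  set x := ‖c α‖
  set y := ‖monom α (z : EuclideanSpace ℂ (Fin d))‖
  have h4 : 0 ≤ x * y := by positivity
  have h5 : 0 ≤ (weight α)⁻¹ * (weight α * x - y) ^ 2 := by positivity
  have h6 : (weight α)⁻¹ * (weight α * x - y) ^ 2 =
      weight α * x ^ 2 - 2 * (x * y) + (weight α)⁻¹ * y ^ 2 := by
    field_simp
    ring
  linarith

namespace DruryArveson

variable {d : ℕ}

lemma coeff_eq {f : DruryArveson d} {c : (Fin d → ℕ) → ℂ} (h : IsCoeff f.eval c) : f.coeff = c :=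
  f.isCoeff_coeff.unique h

lemma norm_sqrt_weight_mul (α : Fin d → ℕ) (x : ℂ) :
    ‖((√(weight α) : ℝ) : ℂ) * x‖ ^ 2 = weight α * ‖x‖ ^ 2 := by
  rw [norm_mul, mul_pow, Complex.norm_real, Real.norm_of_nonneg (Real.sqrt_nonneg _),
    Real.sq_sqrt (weight_pos α).le]

lemma sqrt_weight_ne_zero (α : Fin d → ℕ) : ((√(weight α) : ℝ) : ℂ) ≠ 0 := by
  exact_mod_cast (Real.sqrt_pos.2 (weight_pos α)).ne'

lemma summable_ofCoord (a : lp (fun _ : Fin d → ℕ => ℂ) 2) :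
    Summable fun α => weight α * ‖((√(weight α) : ℝ) : ℂ)⁻¹ * a α‖ ^ 2 := by
  refine ((lp.memℓp a).summable (by norm_num)).congr fun α => ?_
  rw [← norm_sqrt_weight_mul, mul_inv_cancel_left₀ (sqrt_weight_ne_zero α)]
  simp

/-- The function `∑ a_α (|α|! / α!)^{1/2} x^α` for a square-summable family `a`. -/
def ofCoord (a : lp (fun _ : Fin d → ℕ => ℂ) 2) : DruryArveson d :=
  ⟨fun z => ∑' α, (((√(weight α) : ℝ) : ℂ)⁻¹ * a α) * monom α (z : EuclideanSpace ℂ (Fin d)),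
    fun α => ((√(weight α) : ℝ) : ℂ)⁻¹ * a α, summable_ofCoord a,
    fun z => (summable_of_weighted (summable_ofCoord a) z).hasSum⟩

lemma coeff_ofCoord (a : lp (fun _ : Fin d → ℕ => ℂ) 2) :
    (ofCoord a).coeff = fun α => ((√(weight α) : ℝ) : ℂ)⁻¹ * a α :=
  coeff_eq ⟨summable_ofCoord a, fun z => (summable_of_weighted (summable_ofCoord a) z).hasSum⟩

/-- The linear bijection of `H²_d` with `ℓ²(ℕ^d)` that sends `∑ c_α x^α` to the family
`(α! / |α|!)^{1/2} c_α`, that is, to the coordinates of the function with respect to the weighted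
monomials `(|α|! / α!)^{1/2} x^α`. -/
def coordEquiv (d : ℕ) : DruryArveson d ≃ₗ[ℂ] lp (fun _ : Fin d → ℕ => ℂ) 2 where
  toFun f := ⟨fun α => ((√(weight α) : ℝ) : ℂ) * f.coeff α, memℓp_gen (by
    refine f.isCoeff_coeff.1.congr fun α => ?_
    rw [← norm_sqrt_weight_mul]
    simp)⟩
  map_add' f g := by
    ext α
    have h : (f + g).coeff = f.coeff + g.coeff :=
      coeff_eq (by rw [eval_add]; exact f.isCoeff_coeff.add g.isCoeff_coeff)
    exact (congrArg (fun c => ((√(weight α) : ℝ) : ℂ) * c α) h).trans (mul_add _ _ _)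
  map_smul' r f := by
    ext α
    have h : (r • f).coeff = r • f.coeff :=
      coeff_eq (by rw [eval_smul]; exact f.isCoeff_coeff.smul r)
    exact (congrArg (fun c => ((√(weight α) : ℝ) : ℂ) * c α) h).trans (mul_left_comm _ _ _)
  invFun := ofCoord
  left_inv f := by
    apply eval_injective
    funext z
    have h1 := (f.isCoeff_coeff.2 z).tsum_eq
    rw [← h1]
    refine tsum_congr fun α => ?_
    exact congrArg (· * monom α (z : EuclideanSpace ℂ (Fin d)))
      (inv_mul_cancel_left₀ (sqrt_weight_ne_zero α) (f.coeff α))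
  right_inv a := by
    ext α
    exact (congrArg (fun c => ((√(weight α) : ℝ) : ℂ) * c α) (coeff_ofCoord a)).trans
      (mul_inv_cancel_left₀ (sqrt_weight_ne_zero α) (a α))

lemma coordEquiv_apply (f : DruryArveson d) (α : Fin d → ℕ) :
    coordEquiv d f α = ((√(weight α) : ℝ) : ℂ) * f.coeff α := rfl

/-- The norm of `H²_d`: `‖∑ c_α x^α‖² = ∑ α! / |α|! * |c_α|²`. -/
instance : NormedAddCommGroup (DruryArveson d) :=
  NormedAddCommGroup.induced (DruryArveson d) (lp (fun _ : Fin d → ℕ => ℂ) 2)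
    (coordEquiv d).toLinearMap (coordEquiv d).injective

lemma norm_def (f : DruryArveson d) : ‖f‖ = ‖coordEquiv d f‖ := rfl

/-- The inner product of `H²_d`:
`⟪∑ a_α x^α, ∑ b_α x^α⟫ = ∑ α! / |α|! * conj (a_α) * b_α`. -/
instance : InnerProductSpace ℂ (DruryArveson d) where
  norm_smul_le r f := by
    rw [norm_def, norm_def, map_smul, norm_smul]
  inner f g := ⟪coordEquiv d f, coordEquiv d g⟫_ℂ
  norm_sq_eq_re_inner f := by
    rw [norm_def]
    exact norm_sq_eq_re_inner _
  conj_inner_symm f g := inner_conj_symm _ _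
  add_left f g h := by
    rw [map_add, inner_add_left]
  smul_left f g r := by
    rw [map_smul, inner_smul_left]

/-- `coordEquiv` is unitary. -/
def coordIsometry (d : ℕ) : DruryArveson d ≃ₗᵢ[ℂ] lp (fun _ : Fin d → ℕ => ℂ) 2 where
  toLinearEquiv := coordEquiv d
  norm_map' _ := rfl

instance : CompleteSpace (DruryArveson d) :=
  (coordIsometry d).symm.toIsometryEquiv.completeSpace_iff.1 inferInstance

lemma hasSum_norm_sq (f : DruryArveson d) :
    HasSum (fun α => weight α * ‖f.coeff α‖ ^ 2) (‖f‖ ^ 2) := by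
  have h := lp.hasSum_norm (p := 2) (by norm_num) (coordEquiv d f)
  rw [← norm_def] at h
  have e : (2 : ENNReal).toReal = ((2 : ℕ) : ℝ) := by norm_num
  simp only [e, Real.rpow_natCast, coordEquiv_apply, norm_sqrt_weight_mul] at h
  exact h

/-- The coefficients of `x_k f`. -/
def shiftCoeff (k : Fin d) (c : (Fin d → ℕ) → ℂ) (β : Fin d → ℕ) : ℂ :=
  if β k = 0 then 0 else c (β - Pi.single k 1)

lemma shift_injective (k : Fin d) :
    Function.Injective (fun α : Fin d → ℕ => α + Pi.single k 1) :=
  fun _ _ h => add_right_cancel h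

lemma shiftCoeff_add (k : Fin d) (c : (Fin d → ℕ) → ℂ) (α : Fin d → ℕ) :
    shiftCoeff k c (α + Pi.single k 1) = c α := by
  simp [shiftCoeff]

lemma shiftCoeff_of_notMem (k : Fin d) (c : (Fin d → ℕ) → ℂ) (β : Fin d → ℕ)
    (h : β ∉ Set.range (fun α : Fin d → ℕ => α + Pi.single k 1)) : shiftCoeff k c β = 0 := by
  by_contra hne
  have hk : β k ≠ 0 := fun h0 => hne (by simp [shiftCoeff, h0])
  refine h ⟨β - Pi.single k 1, ?_⟩
  funext i
  by_cases hi : i = k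
  · subst hi
    simp
    omega
  · simp [hi]

lemma weight_shift_le (k : Fin d) (α : Fin d → ℕ) : weight (α + Pi.single k 1) ≤ weight α := by
  have h1 : ∑ i, (α + Pi.single k 1 : Fin d → ℕ) i = ∑ i, α i + 1 := by
    simp [Finset.sum_add_distrib]
  have h2 : ∏ i, ((α + Pi.single k 1 : Fin d → ℕ) i)! = (α k + 1) * ∏ i, (α i)! := by
    rw [← Finset.mul_prod_erase _ _ (Finset.mem_univ k),
      ← Finset.mul_prod_erase _ (fun i => (α i)!) (Finset.mem_univ k)]
    have h3 : ∏ i ∈ Finset.univ.erase k, ((α + Pi.single k 1 : Fin d → ℕ) i)! =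
        ∏ i ∈ Finset.univ.erase k, (α i)! :=
      Finset.prod_congr rfl fun i hi => by simp [Finset.ne_of_mem_erase hi]
    rw [h3]
    simp [Nat.factorial_succ]
    ring
  have h4 : α k ≤ ∑ i, α i := Finset.single_le_sum (fun i _ => Nat.zero_le _) (Finset.mem_univ k)
  have h4' : (α k : ℝ) + 1 ≤ ((∑ i, α i : ℕ) : ℝ) + 1 := by exact_mod_cast Nat.succ_le_succ h4
  rw [weight, weight, h1, h2, Nat.factorial_succ, Nat.cast_mul, Nat.cast_mul]
  have h5 : (0 : ℝ) < ((∑ i, α i)! : ℕ) := by exact_mod_cast Nat.factorial_pos _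
  push_cast at h4' h5 ⊢
  rw [div_le_div_iff₀ (by positivity) h5]
  have h6 : (0 : ℝ) ≤ (∏ i, ((α i)! : ℝ)) * ((∑ i, α i)! : ℕ) := by positivity
  nlinarith [mul_le_mul_of_nonneg_left h4' h6]

lemma isCoeff_shift {f : UnitBall d → ℂ} {c : (Fin d → ℕ) → ℂ} (k : Fin d) (h : IsCoeff f c) :
    IsCoeff (fun z => (z : EuclideanSpace ℂ (Fin d)) k * f z) (shiftCoeff k c) := by
  refine ⟨?_, fun z => ?_⟩
  · rw [← (shift_injective k).summable_iff]
    · refine Summable.of_nonneg_of_le (fun α => ?_) (fun α => ?_) h.1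
      · have := weight_pos (α + Pi.single k 1)
        simp only [Function.comp_apply]
        positivity
      · simp only [Function.comp_apply, shiftCoeff_add]
        exact mul_le_mul_of_nonneg_right (weight_shift_le k α) (by positivity)
    · intro β hβ
      simp [shiftCoeff_of_notMem k c β hβ]
  · rw [← (shift_injective k).hasSum_iff]
    · refine ((h.2 z).mul_left ((z : EuclideanSpace ℂ (Fin d)) k)).congr_fun fun α => ?_
      simp only [Function.comp_apply, shiftCoeff_add, monom, Pi.add_apply, pow_add,
        Finset.prod_mul_distrib]
      have : ∏ i, (z : EuclideanSpace ℂ (Fin d)) i ^ (Pi.single k 1 : Fin d → ℕ) i =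
          (z : EuclideanSpace ℂ (Fin d)) k := by
        rw [Finset.prod_eq_single k]
        · simp
        · intro i _ hi
          simp [hi]
        · simp
      rw [this]
      ring
    · intro β hβ
      simp [shiftCoeff_of_notMem k c β hβ]

/-- Multiplication by the coordinate function `x_k` as a linear map of `H²_d`. -/
def mulCoordLinear (k : Fin d) : DruryArveson d →ₗ[ℂ] DruryArveson d where
  toFun f := ⟨fun z => (z : EuclideanSpace ℂ (Fin d)) k * f.eval z, _,
    isCoeff_shift k f.isCoeff_coeff⟩
  map_add' f g := by
    apply eval_injective
    funext z
    exact mul_add _ _ _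
  map_smul' r f := by
    apply eval_injective
    funext z
    exact mul_left_comm _ _ _

lemma coeff_mulCoordLinear (k : Fin d) (f : DruryArveson d) :
    (mulCoordLinear k f).coeff = shiftCoeff k f.coeff :=
  coeff_eq (isCoeff_shift k f.isCoeff_coeff)

lemma norm_mulCoordLinear_le (k : Fin d) (f : DruryArveson d) : ‖mulCoordLinear k f‖ ≤ ‖f‖ := by
  have h1 := hasSum_norm_sq (mulCoordLinear k f)
  rw [coeff_mulCoordLinear, ← (shift_injective k).hasSum_iff (fun β hβ => by
    simp [shiftCoeff_of_notMem k _ β hβ])] at h1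
  have h2 : ‖mulCoordLinear k f‖ ^ 2 ≤ ‖f‖ ^ 2 := by
    refine hasSum_le (fun α => ?_) h1 (hasSum_norm_sq f)
    simp only [Function.comp_apply, shiftCoeff_add]
    exact mul_le_mul_of_nonneg_right (weight_shift_le k α) (by positivity)
  exact le_of_sq_le_sq h2 (norm_nonneg _)

/-- The operator `M_{x_k}` on `H²_d`: multiplication by the coordinate function `x_k`. -/
def mulCoord (k : Fin d) : DruryArveson d →L[ℂ] DruryArveson d :=
  (mulCoordLinear k).mkContinuous 1 (fun f => by simpa using norm_mulCoordLinear_le k f)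

lemma mulCoord_eval (k : Fin d) (f : DruryArveson d) (z : UnitBall d) :
    (mulCoord k f).eval z = (z : EuclideanSpace ℂ (Fin d)) k * f.eval z := rfl

end DruryArveson

end RowShift

end

/-!
The theorem says that the creation operators, and in the commutative case the coordinate
multiplications on `H²_d`, are universal for cyclic pure row contractions. It rests on the isometric
dilation of a pure row contraction together with the Wold decomposition.

*Dilation* (`exists_dilation`). Let `Δ^* Δ = 1 - ∑ T_k T_k^*`. By purity `V x = (Δ T_w^* x)_w` is an
isometry of `H` into the `ℓ²`-families indexed by words, and `V^* S_k = T_k V^*` for the shifts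
`S_k` that prefix words with the letter `k`.

*Wold decomposition* (`IsRowIsometry.mem_cyclicSpan_wandering`). Let `ξ` be a cyclic vector of `T`
and `M` the closed span of all `S_w V ξ`. The component `η` of `V ξ` orthogonal to all `S_w V ξ`
with `w` nonempty is a wandering vector, that is, the `S_w η` are pairwise orthogonal, and since the
shifts are pure the `S_w η` span a dense subspace of `M`. If `η ≠ 0`, normalizing `η` makes
`e_w ↦ S_w η` an isometry `Y` of the full Fock space onto `M` that intertwines the creation
operators with the shifts. Then `X = V^* Y` is a contractive intertwiner, and the closure of its
range is an invariant subspace that contains `V^* V ξ = ξ`, hence is everything. If `η = 0`, then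
`ξ = 0` and `H = 0`.

*Commuting operators* (`exists_druryArveson_model`). The space `H²_d` embeds isometrically into the
full Fock space when `x^α` is sent to the average of the basis vectors `e_w` over the `|α|! / α!`
words `w` with `α_i` letters `i`. When the `T_k` commute, `X e_w = T_w X Ω` depends only on these
numbers of letters, so `X` composed with the embedding sends `x^α` to `T^α X Ω`. This is the
required operator.
-/

noncomputable section

namespace RowShift

/-! ### Words of operators and row isometries -/

section RowIsometry

variable {d : ℕ} {K : Type*} [NormedAddCommGroup K] [InnerProductSpace ℂ K]

@[simp] lemma wordOp_nil (S : Fin d → K →L[ℂ] K) : wordOp S [] = 1 := rfl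

lemma wordOp_cons (S : Fin d → K →L[ℂ] K) (k : Fin d) (w : List (Fin d)) :
    wordOp S (k :: w) = S k * wordOp S w := by
  simp [wordOp]

lemma wordOp_cons_apply (S : Fin d → K →L[ℂ] K) (k : Fin d) (w : List (Fin d)) (x : K) :
    wordOp S (k :: w) x = S k (wordOp S w x) := by
  rw [wordOp_cons]; rfl

lemma wordOp_append (S : Fin d → K →L[ℂ] K) (w v : List (Fin d)) :
    wordOp S (w ++ v) = wordOp S w * wordOp S v := by
  simp [wordOp]

lemma adjoint_wordOp_nil [CompleteSpace K] (S : Fin d → K →L[ℂ] K) (x : K) :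
    ContinuousLinearMap.adjoint (wordOp S []) x = x := by
  refine ext_inner_left ℂ fun z => ?_
  rw [ContinuousLinearMap.adjoint_inner_right]
  rfl

lemma adjoint_wordOp_append [CompleteSpace K] (S : Fin d → K →L[ℂ] K) (w v : List (Fin d))
    (x : K) : ContinuousLinearMap.adjoint (wordOp S (w ++ v)) x =
      ContinuousLinearMap.adjoint (wordOp S v) (ContinuousLinearMap.adjoint (wordOp S w) x) := by
  rw [wordOp_append, ContinuousLinearMap.mul_def, ContinuousLinearMap.adjoint_comp,
    ContinuousLinearMap.comp_apply]

lemma adjoint_wordOp_cons [CompleteSpace K] (S : Fin d → K →L[ℂ] K) (k : Fin d)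
    (w : List (Fin d)) (x : K) : ContinuousLinearMap.adjoint (wordOp S (k :: w)) x =
      ContinuousLinearMap.adjoint (wordOp S w) (ContinuousLinearMap.adjoint (S k) x) := by
  rw [wordOp_cons, ContinuousLinearMap.mul_def, ContinuousLinearMap.adjoint_comp,
    ContinuousLinearMap.comp_apply]

/-- `S` is a row isometry: its entries are isometries with mutually orthogonal ranges. -/
def IsRowIsometry (S : Fin d → K →L[ℂ] K) : Prop :=
  ∀ j k x y, ⟪S j x, S k y⟫_ℂ = if j = k then ⟪x, y⟫_ℂ else 0

/-- A unit vector that is orthogonal to its proper translates under a row isometry is wandering: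
all its translates are orthonormal. -/
lemma IsRowIsometry.orthonormal {S : Fin d → K →L[ℂ] K} (hS : IsRowIsometry S) {η : K}
    (h1 : ‖η‖ = 1) (h : ∀ k w, ⟪η, wordOp S (k :: w) η⟫_ℂ = 0) :
    Orthonormal ℂ (fun w => wordOp S w η) := by
  rw [orthonormal_iff_ite]
  intro v
  induction v with
  | nil =>
    rintro (_ | ⟨k, w⟩)
    · simp [inner_self_eq_norm_sq_to_K, h1]
    · simpa using h k w
  | cons j v ih =>
    rintro (_ | ⟨k, w⟩)
    · rw [← inner_conj_symm, wordOp_nil, one_apply_eq_self, h j v]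
      simp
    · rw [wordOp_cons_apply, wordOp_cons_apply, hS, ih]
      by_cases hjk : j = k <;> simp [hjk]

end RowIsometry

/-! ### Isometries defined on a Hilbert basis -/

section Basis

variable {ι E F : Type*} [NormedAddCommGroup E] [InnerProductSpace ℂ E]
  [NormedAddCommGroup F] [InnerProductSpace ℂ F]

/-- A Hilbert basis can be mapped to any orthonormal family by a linear isometry. -/
lemma exists_isometry_of_orthonormal [CompleteSpace F] (b : HilbertBasis ι ℂ E) {v : ι → F}
    (hv : Orthonormal ℂ v) : ∃ J : E →ₗᵢ[ℂ] F, ∀ i, J (b i) = v i := by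
  classical
  refine ⟨hv.orthogonalFamily.linearIsometry.comp b.repr.toLinearIsometry, fun i => ?_⟩
  change hv.orthogonalFamily.linearIsometry (b.repr (b i)) = v i
  rw [b.repr_self, hv.orthogonalFamily.linearIsometry_apply_single]
  simp

lemma ext_on_basis (b : HilbertBasis ι ℂ E) {A B : E →L[ℂ] F} (h : ∀ i, A (b i) = B (b i)) :
    A = B := by
  refine ContinuousLinearMap.ext_on (s := Set.range b) ?_ ?_
  · rw [dense_iff_closure_eq, ← Submodule.topologicalClosure_coe, b.dense_span]
    rfl
  · rintro _ ⟨i, rfl⟩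
    exact h i

end Basis

/-! ### The orthonormal basis of the full Fock space -/

section Fock

variable {d : ℕ}

lemma creation_apply_zero (k : Fin d) (v : FullFock d) : creation k v 0 = 0 := rfl

lemma creation_apply_succ (k : Fin d) (v : FullFock d) (n : ℕ) :
    creation k v (n + 1) = tensorLeft k n (v n) := rfl

lemma isRowIsometry_creation : IsRowIsometry (creation (d := d)) := by
  intro j k x y
  by_cases hjk : j = k
  · subst hjk
    rw [if_pos rfl]
    exact (creationIsometry j).inner_map_map x y
  · rw [if_neg hjk, lp.inner_eq_tsum]
    have : ∀ n, ⟪creation j x n, creation k y n⟫_ℂ = 0 := by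
      rintro (_ | n)
      · rw [creation_apply_zero, inner_zero_left]
      · rw [creation_apply_succ, creation_apply_succ]
        refine (TensorProduct.inner_tmul (𝕜 := ℂ) (EuclideanSpace.single j (1 : ℂ))
          (EuclideanSpace.single k (1 : ℂ)) (x n) (y n)).trans ?_
        simp [EuclideanSpace.inner_single_left, hjk]
    simp [this]

/-- The scalar `1` as an element of `(ℂ^d)^{⊗ 0} = ℂ`. -/
def tensorOne (d : ℕ) : TensorPow d 0 := (1 : ℂ)

lemma exists_smul_tensorOne (x : TensorPow d 0) : ∃ a : ℂ, x = a • tensorOne d :=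
  ⟨(show ℂ from x), (mul_one (show ℂ from x)).symm⟩

/-- The vacuum vector `Ω`. -/
def vacuum (d : ℕ) : FullFock d := lp.single 2 0 (tensorOne d)

lemma vacuum_apply_zero : vacuum d 0 = tensorOne d := lp.single_apply_self 2 0 (tensorOne d)

lemma norm_vacuum : ‖vacuum d‖ = 1 := by
  rw [vacuum, lp.norm_single (by norm_num)]
  exact norm_one (α := ℂ)

lemma vacuum_apply_succ (n : ℕ) : vacuum d (n + 1) = 0 :=
  lp.single_apply_ne 2 0 (tensorOne d) (Nat.succ_ne_zero n)

lemma wordOp_creation_apply_of_ne (w : List (Fin d)) {n : ℕ} (h : n ≠ w.length) :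
    wordOp creation w (vacuum d) n = 0 := by
  induction w generalizing n with
  | nil =>
    obtain ⟨m, rfl⟩ := Nat.exists_eq_succ_of_ne_zero h
    exact vacuum_apply_succ m
  | cons k w ih =>
    rw [wordOp_cons_apply]
    cases n with
    | zero => rfl
    | succ n =>
      rw [creation_apply_succ, ih (by simpa using h), map_zero]

lemma inner_vacuum_creation (k : Fin d) (v : FullFock d) : ⟪vacuum d, creation k v⟫_ℂ = 0 := by
  rw [vacuum, lp.inner_single_left, creation_apply_zero, inner_zero_right]

lemma orthonormal_fock : Orthonormal ℂ fun w => wordOp creation w (vacuum d) :=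
  isRowIsometry_creation.orthonormal norm_vacuum fun k w => by
    rw [wordOp_cons_apply, inner_vacuum_creation]

/-- The homogeneous component of degree `n` is spanned by the tensors
`e_{i₁} ⊗ ⋯ ⊗ e_{i_n}`. -/
lemma span_homogeneous (n : ℕ) :
    Submodule.span ℂ {x : TensorPow d n | ∃ w : List (Fin d), w.length = n ∧
      x = wordOp creation w (vacuum d) n} = ⊤ := by
  induction n with
  | zero =>
    refine eq_top_iff.2 fun x _ => ?_
    obtain ⟨a, rfl⟩ := exists_smul_tensorOne x
    rw [← vacuum_apply_zero]
    exact Submodule.smul_mem _ _ (Submodule.subset_span ⟨[], rfl, rfl⟩)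
  | succ n ih =>
    set P := Submodule.span ℂ {x : TensorPow d (n + 1) | ∃ w : List (Fin d), w.length = n + 1 ∧
      x = wordOp creation w (vacuum d) (n + 1)} with hP
    have h1 : ∀ k (y : TensorPow d n), tensorLeft k n y ∈ P := by
      intro k y
      have : y ∈ Submodule.span ℂ {x : TensorPow d n | ∃ w : List (Fin d), w.length = n ∧
        x = wordOp creation w (vacuum d) n} := ih ▸ Submodule.mem_top
      refine (Submodule.span_le.2 ?_ : _ ≤ P.comap (tensorLeft k n)) this
      rintro _ ⟨w, hw, rfl⟩
      refine Submodule.subset_span ⟨k :: w, by simp [hw], ?_⟩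
      rw [wordOp_cons_apply, creation_apply_succ]
    refine eq_top_iff.2 fun x _ => ?_
    refine TensorProduct.induction_on
      (motive := fun x : EuclideanSpace ℂ (Fin d) ⊗[ℂ] TensorPow d n =>
        (show TensorPow d (n + 1) from x) ∈ P) x P.zero_mem ?_
      (fun _ _ hx hy => P.add_mem hx hy)
    intro u y
    have hu : u = ∑ k, u k • EuclideanSpace.single k (1 : ℂ) := by
      ext i
      simp [Pi.single_apply]
    have h2 : u ⊗ₜ[ℂ] y = ∑ k, u k • (EuclideanSpace.single k (1 : ℂ) ⊗ₜ[ℂ] y) := by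
      conv_lhs => rw [hu]
      rw [TensorProduct.sum_tmul]
      rfl
    rw [h2]
    exact P.sum_mem fun k _ => P.smul_mem _ (h1 k y)

/-- The Hilbert basis of the full Fock space formed by the tensors `e_w`, `w` a word. -/
def fockBasis (d : ℕ) : HilbertBasis (List (Fin d)) ℂ (FullFock d) :=
  HilbertBasis.mkOfOrthogonalEqBot orthonormal_fock (by
    rw [Submodule.eq_bot_iff]
    intro f hf
    rw [Submodule.mem_orthogonal] at hf
    ext n
    have h : ∀ x : TensorPow d n, ⟪x, f n⟫_ℂ = 0 := by
      intro x
      have hx : x ∈ Submodule.span ℂ {x : TensorPow d n | ∃ w : List (Fin d), w.length = n ∧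
        x = wordOp creation w (vacuum d) n} := span_homogeneous n ▸ Submodule.mem_top
      refine Submodule.span_induction ?_ (inner_zero_left _) ?_ ?_ hx
      · rintro _ ⟨w, rfl, rfl⟩
        rw [← hf _ (Submodule.subset_span ⟨w, rfl⟩), lp.inner_eq_tsum, tsum_eq_single w.length]
        intro n hn
        rw [wordOp_creation_apply_of_ne w hn, inner_zero_left]
      · intro x y _ _ hx hy
        rw [inner_add_left, hx, hy, add_zero]
      · intro a x _ hx
        rw [inner_smul_left, hx, mul_zero]
    exact inner_self_eq_zero.1 (h _))

lemma fockBasis_apply (w : List (Fin d)) : fockBasis d w = wordOp creation w (vacuum d) := by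
  rw [fockBasis, HilbertBasis.coe_mkOfOrthogonalEqBot]

lemma creation_fockBasis (k : Fin d) (w : List (Fin d)) :
    creation k (fockBasis d w) = fockBasis d (k :: w) := by
  rw [fockBasis_apply, fockBasis_apply, wordOp_cons_apply]

end Fock

/-! ### Cyclic invariant subspaces of pure row isometries -/

section Wold

variable {d : ℕ} {K : Type*} [NormedAddCommGroup K] [InnerProductSpace ℂ K]

/-- The closed invariant subspace generated by `x`: the closed span of all `S_w x`. -/
def cyclicSpan (S : Fin d → K →L[ℂ] K) (x : K) : Submodule ℂ K :=
  (Submodule.span ℂ (Set.range fun w => wordOp S w x)).topologicalClosure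

/-- The closed span of all `S_w x` with `w` a nonempty word. -/
def properSpan (S : Fin d → K →L[ℂ] K) (x : K) : Submodule ℂ K :=
  (Submodule.span ℂ
    (Set.range fun p : Fin d × List (Fin d) => wordOp S (p.1 :: p.2) x)).topologicalClosure

instance [CompleteSpace K] (S : Fin d → K →L[ℂ] K) (x : K) : CompleteSpace (cyclicSpan S x) :=
  inferInstanceAs (CompleteSpace (Submodule.topologicalClosure _))

instance [CompleteSpace K] (S : Fin d → K →L[ℂ] K) (x : K) : CompleteSpace (properSpan S x) :=
  inferInstanceAs (CompleteSpace (Submodule.topologicalClosure _))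

variable (S : Fin d → K →L[ℂ] K)

lemma wordOp_mem_cyclicSpan (x : K) (w : List (Fin d)) : wordOp S w x ∈ cyclicSpan S x :=
  Submodule.le_topologicalClosure _ (Submodule.subset_span ⟨w, rfl⟩)

lemma mem_cyclicSpan_self (x : K) : x ∈ cyclicSpan S x := wordOp_mem_cyclicSpan S x []

lemma wordOp_mem_properSpan (x : K) (k : Fin d) (w : List (Fin d)) :
    wordOp S (k :: w) x ∈ properSpan S x :=
  Submodule.le_topologicalClosure _ (Submodule.subset_span ⟨(k, w), rfl⟩)

lemma cyclicSpan_le {x : K} {P : Submodule ℂ K} (hc : IsClosed (P : Set K)) (hx : x ∈ P)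
    (hP : ∀ k, ∀ y ∈ P, S k y ∈ P) : cyclicSpan S x ≤ P := by
  refine Submodule.topologicalClosure_minimal _ (Submodule.span_le.2 ?_) hc
  rintro _ ⟨w, rfl⟩
  induction w with
  | nil => exact hx
  | cons k w ih =>
    change wordOp S (k :: w) x ∈ P
    rw [wordOp_cons_apply]
    exact hP k _ ih

lemma properSpan_le_cyclicSpan (x : K) : properSpan S x ≤ cyclicSpan S x :=
  Submodule.topologicalClosure_mono (Submodule.span_mono (by
    rintro _ ⟨p, rfl⟩
    exact ⟨p.1 :: p.2, rfl⟩))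

lemma map_mem_properSpan (x : K) (k : Fin d) {y : K} (hy : y ∈ cyclicSpan S x) :
    S k y ∈ properSpan S x := by
  have h : Submodule.span ℂ (Set.range fun w => wordOp S w x) ≤
      (Submodule.span ℂ (Set.range fun p : Fin d × List (Fin d) =>
        wordOp S (p.1 :: p.2) x)).comap (S k : K →ₗ[ℂ] K) := by
    rw [Submodule.span_le]
    rintro _ ⟨w, rfl⟩
    exact Submodule.subset_span ⟨(k, w), wordOp_cons_apply S k w x⟩
  exact map_mem_closure (S k).continuous hy fun y hy => h hy

lemma map_mem_cyclicSpan (x : K) (k : Fin d) {y : K} (hy : y ∈ cyclicSpan S x) :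
    S k y ∈ cyclicSpan S x :=
  properSpan_le_cyclicSpan S x (map_mem_properSpan S x k hy)

/-- A vector orthogonal to `x` and to all `S_w x`, `w` nonempty, that lies in the cyclic subspace
of `x`, vanishes. -/
lemma eq_zero_of_mem_cyclicSpan {x y : K} (hy : y ∈ cyclicSpan S x) (hx : ⟪x, y⟫_ℂ = 0)
    (hp : y ∈ (properSpan S x)ᗮ) : y = 0 := by
  have h : cyclicSpan S x ≤ (ℂ ∙ y)ᗮ := by
    refine Submodule.topologicalClosure_minimal _ (Submodule.span_le.2 ?_)
      (Submodule.isClosed_orthogonal _)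
    rintro _ ⟨w, rfl⟩
    rw [SetLike.mem_coe, Submodule.mem_orthogonal_singleton_iff_inner_left]
    cases w with
    | nil => exact hx
    | cons k w => exact hp _ (wordOp_mem_properSpan S x k w)
  exact inner_self_eq_zero.1 (Submodule.mem_orthogonal_singleton_iff_inner_left.1 (h hy))

variable [CompleteSpace K]

/-- The component of `x` orthogonal to all `S_w x` with `w` nonempty. It generates the wandering
subspace of the restriction of `S` to the cyclic subspace of `x`. -/
def wandering (x : K) : K := x - (properSpan S x).starProjection x

lemma wandering_mem_orthogonal (x : K) : wandering S x ∈ (properSpan S x)ᗮ :=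
  Submodule.sub_starProjection_mem_orthogonal x

lemma wandering_mem_cyclicSpan (x : K) : wandering S x ∈ cyclicSpan S x :=
  Submodule.sub_mem _ (mem_cyclicSpan_self S x)
    (properSpan_le_cyclicSpan S x (Submodule.starProjection_apply_mem _ x))

lemma cyclicSpan_wandering_le (x : K) : cyclicSpan S (wandering S x) ≤ cyclicSpan S x :=
  cyclicSpan_le S (Submodule.isClosed_topologicalClosure _) (wandering_mem_cyclicSpan S x)
    fun k _ hy => map_mem_cyclicSpan S x k hy

lemma wordOp_wandering_mem_properSpan (x : K) (k : Fin d) (w : List (Fin d)) :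
    wordOp S (k :: w) (wandering S x) ∈ properSpan S x := by
  rw [wordOp_cons_apply]
  exact map_mem_properSpan S x k
    (cyclicSpan_wandering_le S x (wordOp_mem_cyclicSpan S _ w))

/-- The cyclic subspace of `x` is the orthogonal sum of the line through the wandering vector and
the closed span of the `S_w x`, `w` nonempty. -/
lemma mem_properSpan_of_inner_wandering {x y : K} (hy : y ∈ cyclicSpan S x)
    (h : ⟪wandering S x, y⟫_ℂ = 0) : y ∈ properSpan S x := by
  set z := y - (properSpan S x).starProjection y with hz
  have hpy : (properSpan S x).starProjection y ∈ properSpan S x :=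
    Submodule.starProjection_apply_mem _ y
  have hzp : z ∈ (properSpan S x)ᗮ := Submodule.sub_starProjection_mem_orthogonal y
  have hz0 : z = 0 := by
    refine eq_zero_of_mem_cyclicSpan S
      (Submodule.sub_mem _ hy (properSpan_le_cyclicSpan S x hpy)) ?_ hzp
    have hx : x = wandering S x + (properSpan S x).starProjection x := by simp [wandering]
    rw [hx, inner_add_left, hzp _ (Submodule.starProjection_apply_mem _ x), hz, inner_sub_right, h,
      (Submodule.mem_orthogonal' _ _).1 (wandering_mem_orthogonal S x) _ hpy]
    simp
  rw [sub_eq_zero.1 hz0]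
  exact hpy

variable {S}

lemma IsRowIsometry.adjoint_apply (hS : IsRowIsometry S) (j k : Fin d) (x : K) :
    ContinuousLinearMap.adjoint (S j) (S k x) = if j = k then x else 0 := by
  refine ext_inner_left ℂ fun y => ?_
  rw [ContinuousLinearMap.adjoint_inner_right, hS]
  split_ifs <;> simp

lemma IsRowIsometry.adjoint_mem_cyclicSpan (hS : IsRowIsometry S) (x : K) (j : Fin d) {y : K}
    (hy : y ∈ properSpan S x) : ContinuousLinearMap.adjoint (S j) y ∈ cyclicSpan S x := by
  have h : Submodule.span ℂ (Set.range fun p : Fin d × List (Fin d) =>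
      wordOp S (p.1 :: p.2) x) ≤ (Submodule.span ℂ (Set.range fun w => wordOp S w x)).comap
        (ContinuousLinearMap.adjoint (S j) : K →ₗ[ℂ] K) := by
    rw [Submodule.span_le]
    rintro _ ⟨⟨k, w⟩, rfl⟩
    rw [SetLike.mem_coe, Submodule.mem_comap]
    change ContinuousLinearMap.adjoint (S j) (wordOp S (k :: w) x) ∈
      Submodule.span ℂ (Set.range fun w => wordOp S w x)
    rw [wordOp_cons_apply, hS.adjoint_apply]
    split_ifs
    · exact Submodule.subset_span ⟨w, rfl⟩
    · exact Submodule.zero_mem _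
  exact map_mem_closure (ContinuousLinearMap.adjoint (S j)).continuous hy fun y hy => h hy

/-- The Wold decomposition of the restriction of a row isometry to the cyclic subspace of `x`: if
a map `e` that vanishes on the ranges of the `S_k` detects every vector through its backward shifts
(so that `S` is pure), then the wandering vector generates the cyclic subspace. -/
lemma IsRowIsometry.mem_cyclicSpan_wandering (hS : IsRowIsometry S) {F : Type*}
    [NormedAddCommGroup F] [InnerProductSpace ℂ F] (e : K →L[ℂ] F) (he : ∀ k y, e (S k y) = 0)
    (hpure : ∀ y, (∀ w, e (ContinuousLinearMap.adjoint (wordOp S w) y) = 0) → y = 0) (x : K) :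
    x ∈ cyclicSpan S (wandering S x) := by
  set E := cyclicSpan S (wandering S x) with hE
  -- It suffices that a vector `y` of the cyclic subspace orthogonal to `E` is zero. Such a `y` is
  -- in the span of the proper translates, and its backward shifts are again orthogonal to `E`.
  have hstep : ∀ y ∈ cyclicSpan S x, y ∈ Eᗮ → y ∈ properSpan S x := fun y hy hyE =>
    mem_properSpan_of_inner_wandering S hy (hyE _ (mem_cyclicSpan_self S _))
  have heN : ∀ y ∈ properSpan S x, e y = 0 := by
    have : properSpan S x ≤ (LinearMap.ker (e : K →ₗ[ℂ] F)) := by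
      refine Submodule.topologicalClosure_minimal _ (Submodule.span_le.2 ?_)
        (isClosed_singleton.preimage e.continuous)
      rintro _ ⟨p, rfl⟩
      change e (wordOp S (p.1 :: p.2) x) = 0
      rw [wordOp_cons_apply, he]
    exact fun y hy => this hy
  have hback : ∀ w : List (Fin d), ∀ y ∈ cyclicSpan S x, y ∈ Eᗮ →
      e (ContinuousLinearMap.adjoint (wordOp S w) y) = 0 := by
    intro w
    induction w with
    | nil =>
      intro y hy hyE
      rw [adjoint_wordOp_nil]
      exact heN y (hstep y hy hyE)
    | cons k w ih =>
      intro y hy hyE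
      rw [adjoint_wordOp_cons]
      refine ih _ (hS.adjoint_mem_cyclicSpan x k (hstep y hy hyE)) fun z hz => ?_
      rw [ContinuousLinearMap.adjoint_inner_right]
      exact hyE _ (map_mem_cyclicSpan S _ k hz)
  have hpE : E.starProjection x ∈ E := Submodule.starProjection_apply_mem _ x
  have h0 : x - E.starProjection x = 0 := by
    refine hpure _ fun w => hback w _ ?_ (Submodule.sub_starProjection_mem_orthogonal x)
    exact Submodule.sub_mem _ (mem_cyclicSpan_self S x) (cyclicSpan_wandering_le S x hpE)
  rw [sub_eq_zero.1 h0]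
  exact hpE

/-- Every vector `x` is in the closure of the range of a contractive intertwiner of the creation
operators with a pure row isometry: the restriction of the row isometry to the cyclic subspace of
`x` is zero or unitarily equivalent to the tuple of creation operators. -/
lemma IsRowIsometry.exists_fock_intertwiner (hS : IsRowIsometry S) {F : Type*}
    [NormedAddCommGroup F] [InnerProductSpace ℂ F] (e : K →L[ℂ] F) (he : ∀ k y, e (S k y) = 0)
    (hpure : ∀ y, (∀ w, e (ContinuousLinearMap.adjoint (wordOp S w) y) = 0) → y = 0) (x : K) :
    ∃ Y : FullFock d →L[ℂ] K, ‖Y‖ ≤ 1 ∧ (∀ k, Y.comp (creation k) = (S k).comp Y) ∧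
      x ∈ closure (Set.range Y) := by
  have hx := hS.mem_cyclicSpan_wandering e he hpure x
  set η := wandering S x with hη
  by_cases h0 : η = 0
  · have hx0 : x = 0 := by
      have h := cyclicSpan_le S (x := η) (P := ⊥) isClosed_singleton ((Submodule.mem_bot ℂ).2 h0)
        (fun k y hy => by rw [(Submodule.mem_bot ℂ).1 hy, map_zero]; exact Submodule.zero_mem _) hx
      exact (Submodule.mem_bot ℂ).1 h
    exact ⟨0, ContinuousLinearMap.opNorm_zero.trans_le zero_le_one, fun k => by simp,
      subset_closure ⟨0, by simp [hx0]⟩⟩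
  set a : ℂ := ((‖η‖ : ℝ) : ℂ) with ha
  have ha0 : a ≠ 0 := by simpa [ha] using h0
  have hη1 : ‖a⁻¹ • η‖ = 1 := by
    rw [norm_smul, norm_inv, ha, Complex.norm_real, norm_norm, inv_mul_cancel₀ (by simpa using h0)]
  have hon : Orthonormal ℂ (fun w => wordOp S w (a⁻¹ • η)) := by
    refine hS.orthonormal hη1 fun k w => ?_
    rw [map_smul, inner_smul_left, inner_smul_right,
      (Submodule.mem_orthogonal' _ _).1 (wandering_mem_orthogonal S x) _
        (wordOp_wandering_mem_properSpan S x k w)]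
    simp
  obtain ⟨Y, hY⟩ := exists_isometry_of_orthonormal (fockBasis d) hon
  refine ⟨Y.toContinuousLinearMap, Y.norm_toContinuousLinearMap_le, fun k => ?_, ?_⟩
  · refine ext_on_basis (fockBasis d) fun w => ?_
    change Y (creation k (fockBasis d w)) = S k (Y (fockBasis d w))
    rw [creation_fockBasis, hY, hY, wordOp_cons_apply]
  · have hle : cyclicSpan S η ≤ (LinearMap.range Y.toLinearMap).topologicalClosure := by
      refine Submodule.topologicalClosure_mono (Submodule.span_le.2 ?_)
      rintro _ ⟨w, rfl⟩
      refine ⟨a • fockBasis d w, ?_⟩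
      change Y _ = wordOp S w η
      rw [map_smul, hY, map_smul, smul_inv_smul₀ ha0]
    exact hle hx

end Wold

/-! ### The shifts on families of vectors indexed by words -/

section WordShift

variable {d : ℕ} {H : Type*} [NormedAddCommGroup H]

/-- Square-summable families of vectors of `H` indexed by words: a model of the Hilbert space
tensor product of the full Fock space with `H`. -/
abbrev WordSpace (d : ℕ) (H : Type*) [NormedAddCommGroup H] : Type _ :=
  lp (fun _ : List (Fin d) => H) 2

/-- The family `f` moved to the words that begin with `k`. -/
def wordShiftFun (k : Fin d) (f : List (Fin d) → H) : List (Fin d) → H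
  | [] => 0
  | j :: w => if j = k then f w else 0

@[simp] lemma wordShiftFun_cons_self (k : Fin d) (f : List (Fin d) → H) (w : List (Fin d)) :
    wordShiftFun k f (k :: w) = f w := if_pos rfl

lemma wordShiftFun_of_notMem (k : Fin d) (f : List (Fin d) → H) {w : List (Fin d)}
    (hw : w ∉ Set.range (List.cons k)) : wordShiftFun k f w = 0 := by
  cases w with
  | nil => rfl
  | cons j w => exact if_neg fun h => hw ⟨w, by rw [h]⟩

lemma hasSum_wordShiftFun (k : Fin d) (f : WordSpace d H) :
    HasSum (fun w => ‖wordShiftFun k f w‖ ^ (2 : ENNReal).toReal)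
      (‖f‖ ^ (2 : ENNReal).toReal) := by
  rw [← (List.cons_injective (a := k)).hasSum_iff fun w hw => by
    simp [wordShiftFun_of_notMem k _ hw]]
  simpa [Function.comp_def] using lp.hasSum_norm (p := 2) (by norm_num) f

lemma wordShiftFun_add (k : Fin d) (f g : List (Fin d) → H) :
    wordShiftFun k (f + g) = wordShiftFun k f + wordShiftFun k g := by
  funext w
  rcases w with _ | ⟨j, w⟩
  · exact (add_zero (0 : H)).symm
  · by_cases h : j = k <;> simp [wordShiftFun, h]

variable [InnerProductSpace ℂ H]

lemma wordShiftFun_smul (k : Fin d) (c : ℂ) (f : List (Fin d) → H) :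
    wordShiftFun k (c • f) = c • wordShiftFun k f := by
  funext w
  rcases w with _ | ⟨j, w⟩
  · exact (smul_zero (A := H) c).symm
  · by_cases h : j = k <;> simp [wordShiftFun, h]

/-- The isometry of `WordSpace d H` that prefixes all words with `k`. -/
def wordShiftIsometry (k : Fin d) : WordSpace d H →ₗᵢ[ℂ] WordSpace d H where
  toFun f := ⟨wordShiftFun k f, memℓp_gen (hasSum_wordShiftFun k f).summable⟩
  map_add' f g := Subtype.ext (wordShiftFun_add k f g)
  map_smul' c f := Subtype.ext (wordShiftFun_smul k c f)
  norm_map' f := by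
    have h := (lp.hasSum_norm (p := 2) (by norm_num)
      (⟨wordShiftFun k f, memℓp_gen (hasSum_wordShiftFun k f).summable⟩ : WordSpace d H)).unique
      (hasSum_wordShiftFun k f)
    simpa using h

/-- The operator on `WordSpace d H` that prefixes all words with `k`. -/
def wordShift (k : Fin d) : WordSpace d H →L[ℂ] WordSpace d H :=
  (wordShiftIsometry k).toContinuousLinearMap

lemma wordShift_apply (k : Fin d) (f : WordSpace d H) (w : List (Fin d)) :
    wordShift k f w = wordShiftFun k f w := rfl

lemma isRowIsometry_wordShift : IsRowIsometry (wordShift (d := d) (H := H)) := by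
  intro j k f g
  by_cases hjk : j = k
  · subst hjk
    rw [if_pos rfl]
    exact (wordShiftIsometry j).inner_map_map f g
  · rw [if_neg hjk, lp.inner_eq_tsum]
    refine (tsum_congr fun w => ?_).trans tsum_zero
    rcases w with _ | ⟨i, w⟩
    · exact inner_zero_left _
    · rw [wordShift_apply, wordShift_apply]
      by_cases hi : i = j
      · have : i ≠ k := hi ▸ hjk
        simp [wordShiftFun, this]
      · simp [wordShiftFun, hi]

variable [CompleteSpace H]

/-- The adjoint of the shift removes the prefix `k`. -/
lemma adjoint_wordShift_apply (k : Fin d) (f : WordSpace d H) (w : List (Fin d)) :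
    ContinuousLinearMap.adjoint (wordShift k) f w = f (k :: w) := by
  classical
  refine ext_inner_left ℂ fun u => ?_
  have h1 : ⟪u, ContinuousLinearMap.adjoint (wordShift k) f w⟫_ℂ =
      ⟪(lp.single 2 w u : WordSpace d H), ContinuousLinearMap.adjoint (wordShift k) f⟫_ℂ :=
    (lp.inner_single_left (G := fun _ : List (Fin d) => H) w u _).symm
  rw [h1, ContinuousLinearMap.adjoint_inner_right, lp.inner_eq_tsum, tsum_eq_single (k :: w)]
  · rw [wordShift_apply, wordShiftFun_cons_self, lp.single_apply_self]
  · intro v hv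
    rw [wordShift_apply]
    by_cases hm : v ∈ Set.range (List.cons k)
    · obtain ⟨v, rfl⟩ := hm
      rw [wordShiftFun_cons_self, lp.single_apply_ne _ _ _ (fun h => hv (by rw [h])),
        inner_zero_left]
    · rw [wordShiftFun_of_notMem k _ hm, inner_zero_left]

lemma adjoint_wordOp_wordShift_apply (w v : List (Fin d)) (f : WordSpace d H) :
    ContinuousLinearMap.adjoint (wordOp wordShift w) f v = f (w ++ v) := by
  induction w generalizing f with
  | nil => rw [adjoint_wordOp_nil, List.nil_append]
  | cons k w ih =>
    rw [adjoint_wordOp_cons, ih, adjoint_wordShift_apply]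
    rfl

/-- Every vector of `WordSpace d H` is in the closure of the range of a contractive intertwiner of
the creation operators with the shifts. The shifts are pure because `f w` is the component at
the empty word of the backward shift of `f` along `w`. -/
lemma exists_wordShift_intertwiner (f : WordSpace d H) :
    ∃ Y : FullFock d →L[ℂ] WordSpace d H, ‖Y‖ ≤ 1 ∧
      (∀ k, Y.comp (creation k) = (wordShift k).comp Y) ∧ f ∈ closure (Set.range Y) := by
  refine isRowIsometry_wordShift.exists_fock_intertwiner
    (lp.evalCLM ℂ (fun _ : List (Fin d) => H) 2 []) (fun k g => rfl) (fun g hg => ?_) f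
  ext w
  have h : ContinuousLinearMap.adjoint (wordOp wordShift w) g [] = 0 := hg w
  rw [adjoint_wordOp_wordShift_apply] at h
  rw [List.append_nil] at h
  exact h

end WordShift

/-! ### The isometric dilation of a pure row contraction -/

section Dilation

variable {d : ℕ} {H : Type*} [NormedAddCommGroup H] [InnerProductSpace ℂ H]
  {T : Fin d → H →L[ℂ] H}

lemma rowOperator_apply (ξ : PiLp 2 (fun _ : Fin d => H)) :
    rowOperator T ξ = ∑ k, T k (ξ k) := by
  simp [rowOperator]

/-- An intertwiner has dense range as soon as the closure of its range, which is an invariant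
subspace, contains a cyclic vector. -/
lemma denseRange_of_mem_closure {F : Type*} [NormedAddCommGroup F] [InnerProductSpace ℂ F]
    {S : Fin d → F →L[ℂ] F} {X : F →L[ℂ] H} (hX : ∀ k, X.comp (S k) = (T k).comp X) {ξ : H}
    (hξ : IsCyclicSet T {ξ}) (hmem : ξ ∈ closure (Set.range X)) : DenseRange X := by
  set R := (LinearMap.range (X : F →ₗ[ℂ] H)).topologicalClosure with hR
  have hinv : ∀ k, ∀ x ∈ R, T k x ∈ R := by
    intro k x hx
    refine map_mem_closure (T k).continuous hx ?_
    rintro _ ⟨y, rfl⟩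
    exact ⟨S k y, DFunLike.congr_fun (hX k) y⟩
  have hle : (⊤ : Submodule ℂ H) ≤ R := by
    rw [← hξ]
    refine Submodule.topologicalClosure_minimal _ (Submodule.span_le.2 ?_)
      (Submodule.isClosed_topologicalClosure _)
    rintro _ ⟨w, _, rfl, rfl⟩
    exact cyclicSpan_le T (Submodule.isClosed_topologicalClosure _) hmem hinv
      (wordOp_mem_cyclicSpan T _ w)
  exact fun x => hle (Submodule.mem_top (x := x))

variable [CompleteSpace H]

lemma IsRowContraction.sum_norm_adjoint_sq_le (hT : IsRowContraction T) (x : H) :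
    ∑ k, ‖ContinuousLinearMap.adjoint (T k) x‖ ^ 2 ≤ ‖x‖ ^ 2 := by
  set ξ : PiLp 2 (fun _ : Fin d => H) :=
    WithLp.toLp 2 fun k => ContinuousLinearMap.adjoint (T k) x with hξ
  have h1 : ‖ξ‖ ^ 2 = ∑ k, ‖ContinuousLinearMap.adjoint (T k) x‖ ^ 2 := by
    rw [PiLp.norm_sq_eq_of_L2]
  have h2 : ‖rowOperator T ξ‖ ≤ ‖ξ‖ := by
    simpa using (rowOperator T).le_of_opNorm_le hT ξ
  have h3 : ⟪rowOperator T ξ, x⟫_ℂ = ((‖ξ‖ ^ 2 : ℝ) : ℂ) := by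
    rw [h1, rowOperator_apply, sum_inner]
    push_cast
    refine Finset.sum_congr rfl fun k _ => ?_
    rw [← ContinuousLinearMap.adjoint_inner_right]
    exact inner_self_eq_norm_sq_to_K _
  have h4 : ‖ξ‖ ^ 2 ≤ ‖ξ‖ * ‖x‖ := by
    have h5 := norm_inner_le_norm (𝕜 := ℂ) (rowOperator T ξ) x
    rw [h3, Complex.norm_real, Real.norm_of_nonneg (by positivity)] at h5
    exact h5.trans (by gcongr)
  rw [← h1]
  nlinarith [norm_nonneg ξ, norm_nonneg x, sq_nonneg (‖ξ‖ - ‖x‖)]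

/-- The existence of a defect operator `Δ` of a row contraction: `Δ^* Δ = 1 - ∑ T_k T_k^*`. -/
lemma IsRowContraction.exists_defect (hT : IsRowContraction T) :
    ∃ Δ : H →L[ℂ] H, ∀ x,
      ‖Δ x‖ ^ 2 = ‖x‖ ^ 2 - ∑ k, ‖ContinuousLinearMap.adjoint (T k) x‖ ^ 2 := by
  set D : H →L[ℂ] H := 1 - ∑ k, T k * ContinuousLinearMap.adjoint (T k) with hD
  have hDx : ∀ x, ⟪x, D x⟫_ℂ =
      ((‖x‖ ^ 2 - ∑ k, ‖ContinuousLinearMap.adjoint (T k) x‖ ^ 2 : ℝ) : ℂ) := by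
    intro x
    have h1 : D x = x - ∑ k, T k (ContinuousLinearMap.adjoint (T k) x) := by
      simp [hD]
    rw [h1, inner_sub_right, inner_sum]
    push_cast
    congr 1
    · exact inner_self_eq_norm_sq_to_K _
    · refine Finset.sum_congr rfl fun k _ => ?_
      rw [← ContinuousLinearMap.adjoint_inner_left]
      exact inner_self_eq_norm_sq_to_K _
  have hsa : IsSelfAdjoint D := by
    refine (IsSelfAdjoint.one _).sub (isSelfAdjoint_sum _ fun k _ => ?_)
    exact IsSelfAdjoint.mul_star_self (T k)
  have hpos : 0 ≤ D := by
    rw [ContinuousLinearMap.nonneg_iff_isPositive, ContinuousLinearMap.isPositive_iff']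
    refine ⟨hsa, fun x => ?_⟩
    have h2 : ⟪D x, x⟫_ℂ = ⟪x, D x⟫_ℂ := by
      rw [← ContinuousLinearMap.adjoint_inner_right, hsa.adjoint_eq]
    rw [h2, hDx]
    exact_mod_cast sub_nonneg.2 (hT.sum_norm_adjoint_sq_le x)
  obtain ⟨Δ, hΔ⟩ := CStarAlgebra.nonneg_iff_eq_star_mul_self.1 hpos
  refine ⟨Δ, fun x => ?_⟩
  have h3 := hDx x
  rw [hΔ, ContinuousLinearMap.star_eq_adjoint, mul_apply_eq_comp,
    ContinuousLinearMap.adjoint_inner_right, inner_self_eq_norm_sq_to_K] at h3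
  exact Complex.ofReal_injective ((Complex.ofReal_pow _ 2).trans h3)

lemma hasSum_telescope {a : ℕ → ℝ} (ha : Filter.Tendsto a Filter.atTop (nhds 0))
    (hmono : ∀ n, a (n + 1) ≤ a n) : HasSum (fun n => a n - a (n + 1)) (a 0) := by
  rw [hasSum_iff_tendsto_nat_of_nonneg fun n => sub_nonneg.2 (hmono n)]
  simp only [Finset.sum_range_sub']
  simpa using ha.const_sub (a 0)

/-- For a pure row contraction the defects of the vectors `T_w^* x` add up to `‖x‖²`: the words of
length `n` contribute `a n - a (n + 1)` with `a n = ∑_{|w| = n} ‖T_w^* x‖²`, and `a` tends to `0` by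
purity. -/
lemma hasSum_defect (hpure : IsPure T) {Δ : H →L[ℂ] H} (hΔ : ∀ x,
      ‖Δ x‖ ^ 2 = ‖x‖ ^ 2 - ∑ k, ‖ContinuousLinearMap.adjoint (T k) x‖ ^ 2) (x : H) :
    HasSum (fun w => ‖Δ (ContinuousLinearMap.adjoint (wordOp T w) x)‖ ^ 2) (‖x‖ ^ 2) := by
  set a : ℕ → ℝ := fun n => ∑ w : Fin n → Fin d,
      ‖ContinuousLinearMap.adjoint (wordOp T (List.ofFn w)) x‖ ^ 2 with ha
  have h0 : a 0 = ‖x‖ ^ 2 := by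
    simp [ha, -wordOp_nil, adjoint_wordOp_nil]
  have hstep : ∀ n, ∑ w : Fin n → Fin d,
      ‖Δ (ContinuousLinearMap.adjoint (wordOp T (List.ofFn w)) x)‖ ^ 2 = a n - a (n + 1) := by
    intro n
    have h1 : a (n + 1) = ∑ w : Fin n → Fin d, ∑ k, ‖ContinuousLinearMap.adjoint (T k)
        (ContinuousLinearMap.adjoint (wordOp T (List.ofFn w)) x)‖ ^ 2 := by
      rw [ha]
      simp only
      -- a word of length `n + 1` is a word of length `n` followed by the letter `k`
      rw [← (Fin.snocEquiv fun _ : Fin (n + 1) => Fin d).sum_comp, Fintype.sum_prod_type_right]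
      refine Finset.sum_congr rfl fun w _ => Finset.sum_congr rfl fun k _ => ?_
      have h2 : List.ofFn (Fin.snocEquiv (fun _ : Fin (n + 1) => Fin d) (k, w)) =
          List.ofFn w ++ [k] := by
        rw [List.ofFn_succ']
        simp [Fin.snocEquiv, List.concat_eq_append]
      rw [h2, adjoint_wordOp_append, adjoint_wordOp_cons, adjoint_wordOp_nil]
    rw [h1, ha, ← Finset.sum_sub_distrib]
    exact Finset.sum_congr rfl fun w _ => hΔ _
  have hsum : HasSum (fun n => a n - a (n + 1)) (‖x‖ ^ 2) := by
    rw [← h0]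
    refine hasSum_telescope (hpure x) fun n => ?_
    rw [← sub_nonneg, ← hstep]
    positivity
  rw [← List.equivSigmaTuple.symm.hasSum_iff]
  have hs : Summable ((fun w => ‖Δ (ContinuousLinearMap.adjoint (wordOp T w) x)‖ ^ 2) ∘
      (List.equivSigmaTuple (α := Fin d)).symm) := by
    rw [summable_sigma_of_nonneg fun _ => by simp only [Function.comp_apply]; positivity]
    refine ⟨fun n => (hasSum_fintype _).summable, hsum.summable.congr fun n => ?_⟩
    rw [tsum_fintype, ← hstep]
    rfl
  convert! hs.hasSum using 1
  rw [hs.tsum_sigma, ← hsum.tsum_eq]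
  refine tsum_congr fun n => ?_
  rw [tsum_fintype, ← hstep]
  rfl

/-- A pure row contraction is the compression of the shifts on words to a subspace that is
invariant under their adjoints. The embedding is `V x = (Δ T_w^* x)_w`, with `Δ` the defect
operator. -/
lemma exists_dilation (hrow : IsRowContraction T) (hpure : IsPure T) :
    ∃ V : H →ₗᵢ[ℂ] WordSpace d H, ∀ k,
      (ContinuousLinearMap.adjoint V.toContinuousLinearMap).comp (wordShift k) =
        (T k).comp (ContinuousLinearMap.adjoint V.toContinuousLinearMap) := by
  obtain ⟨Δ, hΔ⟩ := hrow.exists_defect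
  have hsum := hasSum_defect hpure hΔ
  have h2 : (2 : ENNReal).toReal = ((2 : ℕ) : ℝ) := by norm_num
  have hsum' : ∀ x, HasSum (fun w => ‖Δ (ContinuousLinearMap.adjoint (wordOp T w) x)‖ ^
      (2 : ENNReal).toReal) (‖x‖ ^ 2) := by
    intro x
    simpa only [h2, Real.rpow_natCast] using hsum x
  let V : H →ₗᵢ[ℂ] WordSpace d H :=
    { toFun := fun x => ⟨fun w => Δ (ContinuousLinearMap.adjoint (wordOp T w) x),
        memℓp_gen (hsum' x).summable⟩
      map_add' := fun x y => Subtype.ext (funext fun w => by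
        change Δ _ = Δ _ + Δ _
        rw [map_add, map_add])
      map_smul' := fun c x => Subtype.ext (funext fun w => by
        change Δ _ = c • Δ _
        rw [map_smul, map_smul])
      norm_map' := fun x => by
        have h := (lp.hasSum_norm (p := 2) (by norm_num)
          (⟨fun w => Δ (ContinuousLinearMap.adjoint (wordOp T w) x),
            memℓp_gen (hsum' x).summable⟩ : WordSpace d H)).unique (hsum' x)
        simp only [h2, Real.rpow_natCast] at h
        exact (sq_eq_sq₀ (norm_nonneg _) (norm_nonneg _)).1 h }
  refine ⟨V, fun k => ?_⟩
  have hV : (ContinuousLinearMap.adjoint (wordShift k)).comp V.toContinuousLinearMap =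
      V.toContinuousLinearMap.comp (ContinuousLinearMap.adjoint (T k)) := by
    ext x w
    change ContinuousLinearMap.adjoint (wordShift k) (V x) w =
      Δ (ContinuousLinearMap.adjoint (wordOp T w) (ContinuousLinearMap.adjoint (T k) x))
    rw [adjoint_wordShift_apply, ← adjoint_wordOp_cons]
    rfl
  have := congrArg ContinuousLinearMap.adjoint hV
  simpa only [ContinuousLinearMap.adjoint_comp, ContinuousLinearMap.adjoint_adjoint] using this

/-- The creation operators are a universal model of cyclic pure row contractions: the intertwiner is
`V^* Y`, where `V` embeds `H` into the dilation space, and `Y` intertwines the creation operators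
with the shifts and has `V ξ`, `ξ` a cyclic vector, in the closure of its range. -/
lemma exists_fock_model (hrow : IsRowContraction T) (hpure : IsPure T) (hcyc : IsCyclic T) :
    ∃ X : FullFock d →L[ℂ] H, ‖X‖ ≤ 1 ∧ DenseRange X ∧
      ∀ k, X.comp (creation k) = (T k).comp X := by
  obtain ⟨ξ, hξ⟩ := hcyc
  obtain ⟨V, hV⟩ := exists_dilation hrow hpure
  obtain ⟨Y, hY1, hY, hVξ⟩ := exists_wordShift_intertwiner (V ξ)
  set W := ContinuousLinearMap.adjoint V.toContinuousLinearMap with hW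
  have hWV : W (V ξ) = ξ := by
    refine ext_inner_left ℂ fun x => ?_
    rw [hW, ContinuousLinearMap.adjoint_inner_right]
    exact V.inner_map_map x ξ
  have hX : ∀ k, (W.comp Y).comp (creation k) = (T k).comp (W.comp Y) := by
    intro k
    rw [ContinuousLinearMap.comp_assoc, hY, ← ContinuousLinearMap.comp_assoc, hV,
      ContinuousLinearMap.comp_assoc]
  refine ⟨W.comp Y, ?_, denseRange_of_mem_closure hX hξ ?_, hX⟩
  · refine (ContinuousLinearMap.opNorm_comp_le _ _).trans (mul_le_one₀ ?_ (norm_nonneg _) hY1)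
    rw [hW, LinearIsometryEquiv.norm_map]
    exact V.norm_toContinuousLinearMap_le
  · rw [← hWV]
    refine map_mem_closure W.continuous hVξ ?_
    rintro _ ⟨y, rfl⟩
    exact ⟨y, rfl⟩

end Dilation

/-! ### Words with a given number of occurrences of each letter -/

section Words

variable {d : ℕ}

/-- The type of a word: the number of occurrences of each letter. -/
def wordType (w : List (Fin d)) : Fin d → ℕ := fun i => w.count i

@[simp] lemma wordType_nil : wordType ([] : List (Fin d)) = 0 := by
  funext i
  simp [wordType]

lemma wordType_cons (k : Fin d) (w : List (Fin d)) :
    wordType (k :: w) = wordType w + Pi.single k 1 := by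
  funext i
  by_cases h : i = k
  · simp [wordType, h]
  · simp [wordType, h, List.count_cons_of_ne (Ne.symm h)]

lemma sum_wordType (w : List (Fin d)) : ∑ i, wordType w i = w.length := by
  induction w with
  | nil => simp
  | cons k w ih => simp [wordType_cons, Finset.sum_add_distrib, ih]

/-- The words of type `α`. -/
def wordsOfType (α : Fin d → ℕ) : Finset (List (Fin d)) :=
  ((List.finite_length_eq (Fin d) (∑ i, α i)).subset
    (t := {w | wordType w = α}) (by rintro w rfl; exact (sum_wordType w).symm)).toFinset

@[simp] lemma mem_wordsOfType {α : Fin d → ℕ} {w : List (Fin d)} :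
    w ∈ wordsOfType α ↔ wordType w = α := by
  simp [wordsOfType]

lemma wordsOfType_succ {α : Fin d → ℕ} (hα : α ≠ 0) :
    wordsOfType α = (Finset.univ.filter fun k => α k ≠ 0).biUnion fun k =>
      (wordsOfType (α - Pi.single k 1)).map ⟨List.cons k, List.cons_injective⟩ := by
  ext w
  simp only [mem_wordsOfType, Finset.mem_biUnion, Finset.mem_filter, Finset.mem_univ, true_and,
    Finset.mem_map, Function.Embedding.coeFn_mk]
  constructor
  · rintro rfl
    cases w with
    | nil => simp at hα
    | cons k w => exact ⟨k, by simp [wordType_cons], w, by simp [wordType_cons], rfl⟩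
  · rintro ⟨k, hk, w, hw, rfl⟩
    rw [wordType_cons, hw]
    funext i
    by_cases hi : i = k
    · subst hi
      simp
      omega
    · simp [hi]

lemma prod_factorial_pred {α : Fin d → ℕ} {k : Fin d} (hk : α k ≠ 0) :
    ∏ i, (α i)! = α k * ∏ i, ((α - Pi.single k 1 : Fin d → ℕ) i)! := by
  have h1 := Finset.mul_prod_erase Finset.univ (fun i => (α i)!) (Finset.mem_univ k)
  have h2 := Finset.mul_prod_erase Finset.univ
    (fun i => ((α - Pi.single k 1 : Fin d → ℕ) i)!) (Finset.mem_univ k)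
  have h3 : ∏ i ∈ Finset.univ.erase k, ((α - Pi.single k 1 : Fin d → ℕ) i)! =
      ∏ i ∈ Finset.univ.erase k, (α i)! :=
    Finset.prod_congr rfl fun i hi => by simp [Finset.ne_of_mem_erase hi]
  rw [← h1, ← h2, h3, ← mul_assoc]
  simp [Nat.mul_factorial_pred hk]

/-- The number of words of type `α` is the multinomial coefficient `|α|! / α!`. -/
lemma card_wordsOfType_mul (α : Fin d → ℕ) :
    (wordsOfType α).card * ∏ i, (α i)! = (∑ i, α i)! := by
  induction hn : ∑ i, α i generalizing α with
  | zero =>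
    have h0 : α = 0 := by
      funext i
      simpa using (Finset.sum_eq_zero_iff.1 hn) i (Finset.mem_univ i)
    subst h0
    have : wordsOfType (0 : Fin d → ℕ) = {[]} := by
      ext w
      rw [mem_wordsOfType, Finset.mem_singleton]
      refine ⟨fun h => ?_, fun h => by simp [h]⟩
      rw [← List.length_eq_zero_iff, ← sum_wordType, h]
      simp
    simp [this]
  | succ n ih =>
    have hα : α ≠ 0 := by
      rintro rfl
      simp at hn
    rw [wordsOfType_succ hα, Finset.card_biUnion, Finset.sum_mul]
    · have h1 : ∀ k ∈ Finset.univ.filter fun k => α k ≠ 0,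
          ((wordsOfType (α - Pi.single k 1)).map ⟨List.cons k, List.cons_injective⟩).card *
            ∏ i, (α i)! = α k * n ! := by
        intro k hk
        have hk : α k ≠ 0 := by simpa using hk
        have hs : ∑ i, (α - Pi.single k 1 : Fin d → ℕ) i = n := by
          have h2 : α = (α - Pi.single k 1 : Fin d → ℕ) + Pi.single k 1 := by
            funext i
            by_cases hi : i = k
            · subst hi
              simp
              omega
            · simp [hi]
          have h3 : ∑ i, α i = ∑ i, (α - Pi.single k 1 : Fin d → ℕ) i + 1 := by
            conv_lhs => rw [h2]
            simp [Finset.sum_add_distrib]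
          omega
        rw [Finset.card_map, prod_factorial_pred hk, ← ih _ hs]
        ring
      rw [Finset.sum_congr rfl h1, ← Finset.sum_mul, Finset.sum_filter_ne_zero, hn,
        Nat.factorial_succ]
    · intro j _ k _ hjk
      rw [Function.onFun, Finset.disjoint_left]
      intro w hw hw'
      obtain ⟨v, _, rfl⟩ := Finset.mem_map.1 hw
      obtain ⟨v', _, h⟩ := Finset.mem_map.1 hw'
      exact hjk (List.cons.inj h).1.symm

lemma weight_mul_card (α : Fin d → ℕ) : weight α * (wordsOfType α).card = 1 := by
  have h : (0 : ℝ) < ((∑ i, α i)! : ℕ) := by exact_mod_cast Nat.factorial_pos _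
  rw [weight, div_mul_eq_mul_div, div_eq_one_iff_eq h.ne', mul_comm]
  exact_mod_cast card_wordsOfType_mul α

lemma wordsOfType_nonempty (α : Fin d → ℕ) : (wordsOfType α).Nonempty := by
  rw [← Finset.card_pos, Nat.pos_iff_ne_zero]
  intro h
  simpa [h] using weight_mul_card α

/-- For commuting operators `T_w` depends on the type of `w` only. -/
lemma wordOp_eq_of_wordType_eq {H : Type*} [NormedAddCommGroup H] [InnerProductSpace ℂ H]
    {T : Fin d → H →L[ℂ] H} (hT : ∀ j k, T j * T k = T k * T j) {v w : List (Fin d)}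
    (h : wordType v = wordType w) : wordOp T v = wordOp T w := by
  have hp : v.Perm w := List.perm_iff_count.2 fun i => congrFun h i
  refine (hp.map T).prod_eq' ?_
  rw [List.pairwise_map]
  exact List.pairwise_of_forall fun j k => hT j k

end Words

/-! ### The Drury–Arveson space inside the full Fock space -/

section Symmetric

variable {d : ℕ}

/-- The Hilbert basis of `H²_d` formed by the monomials `(|α|! / α!)^{1/2} x^α`. -/
def monomialBasis (d : ℕ) : HilbertBasis (Fin d → ℕ) ℂ (DruryArveson d) :=
  HilbertBasis.ofRepr (DruryArveson.coordIsometry d)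

/-- The normalized symmetric tensor of type `α`: the multiple by `(α! / |α|!)^{1/2}` of the sum of
the basis vectors `e_w` over the words `w` of type `α`. -/
def symVector (α : Fin d → ℕ) : FullFock d :=
  ((√(weight α) : ℝ) : ℂ) • ∑ w ∈ wordsOfType α, fockBasis d w

lemma orthonormal_symVector : Orthonormal ℂ (symVector (d := d)) := by
  classical
  rw [orthonormal_iff_ite]
  intro α β
  have hb := orthonormal_iff_ite.1 (fockBasis d).orthonormal
  simp only [symVector, inner_smul_left, inner_smul_right, sum_inner, inner_sum, hb,
    Complex.conj_ofReal, ← Finset.mul_sum]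
  split_ifs with h
  · subst h
    have h1 : ∑ v ∈ wordsOfType α, ∑ w ∈ wordsOfType α, (if w = v then (1 : ℂ) else 0) =
        (wordsOfType α).card := by
      simp [-mem_wordsOfType]
    rw [h1, ← mul_assoc, ← Complex.ofReal_mul, Real.mul_self_sqrt (weight_pos α).le]
    exact_mod_cast weight_mul_card α
  · rw [Finset.sum_eq_zero, mul_zero, mul_zero]
    intro v hv
    refine Finset.sum_eq_zero fun w hw => if_neg ?_
    rintro rfl
    exact h ((mem_wordsOfType.1 hw).symm.trans (mem_wordsOfType.1 hv))

lemma monomialBasis_eval (α : Fin d → ℕ) (z : UnitBall d) :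
    (monomialBasis d α).eval z = ((√(weight α) : ℝ) : ℂ)⁻¹ * monom α z := by
  classical
  rw [← (monomialBasis d).repr_symm_single]
  change (DruryArveson.ofCoord (lp.single 2 α (1 : ℂ))).eval z = _
  change ∑' β, _ = _
  rw [tsum_eq_single α]
  · rw [lp.single_apply_self, mul_one]
  · intro β hβ
    rw [lp.single_apply_ne _ _ _ hβ, mul_zero, zero_mul]

/-- The monomial `x^α` as an element of `H²_d`. -/
def monomial (α : Fin d → ℕ) : DruryArveson d := ((√(weight α) : ℝ) : ℂ) • monomialBasis d α

lemma monomial_eval (α : Fin d → ℕ) (z : UnitBall d) : (monomial α).eval z = monom α z := by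
  rw [monomial, DruryArveson.eval_smul, Pi.smul_apply, monomialBasis_eval, smul_eq_mul,
    mul_inv_cancel_left₀ (DruryArveson.sqrt_weight_ne_zero α)]

lemma mulCoord_monomial (k : Fin d) (α : Fin d → ℕ) :
    DruryArveson.mulCoord k (monomial α) = monomial (α + Pi.single k 1) := by
  refine DruryArveson.eval_injective (funext fun z => ?_)
  rw [DruryArveson.mulCoord_eval, monomial_eval, monomial_eval]
  simp only [monom, Pi.add_apply, pow_add, Finset.prod_mul_distrib]
  have h : ∏ i, (z : EuclideanSpace ℂ (Fin d)) i ^ (Pi.single k 1 : Fin d → ℕ) i =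
      (z : EuclideanSpace ℂ (Fin d)) k := by
    rw [Fintype.prod_eq_single k fun i hi => by rw [Pi.single_eq_of_ne hi, pow_zero],
      Pi.single_eq_same, pow_one]
  rw [h, mul_comm]

variable {H : Type*} [NormedAddCommGroup H] [InnerProductSpace ℂ H] {T : Fin d → H →L[ℂ] H}

lemma intertwiner_fockBasis {X : FullFock d →L[ℂ] H} (hX : ∀ k, X.comp (creation k) = (T k).comp X)
    (w : List (Fin d)) : X (fockBasis d w) = wordOp T w (X (vacuum d)) := by
  induction w with
  | nil => rw [fockBasis_apply]; rfl
  | cons k w ih =>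
    rw [← creation_fockBasis, wordOp_cons_apply, ← ih]
    exact DFunLike.congr_fun (hX k) _

/-- An intertwiner `X` of the creation operators with commuting operators induces one of the
coordinate multiplications. Embed `H²_d` isometrically into the full Fock space as the symmetric
tensors. The monomial `x^α` becomes the average of the `e_w` over the words `w` of type `α`, and `X`
sends all these `e_w` to the same vector. So the restriction of `X` to the symmetric tensors has the
same values on the monomials as `X` has on the basis `e_w`, which gives the dense range as well as
the intertwining relation. -/
lemma exists_druryArveson_model (hT : ∀ j k, T j * T k = T k * T j) {X : FullFock d →L[ℂ] H}
    (hX1 : ‖X‖ ≤ 1) (hXd : DenseRange X) (hX : ∀ k, X.comp (creation k) = (T k).comp X) :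
    ∃ X' : DruryArveson d →L[ℂ] H, ‖X'‖ ≤ 1 ∧ DenseRange X' ∧
      ∀ k, X'.comp (DruryArveson.mulCoord k) = (T k).comp X' := by
  obtain ⟨J, hJ⟩ := exists_isometry_of_orthonormal (monomialBasis d) orthonormal_symVector
  set h := X (vacuum d) with hh
  set X' : DruryArveson d →L[ℂ] H := X.comp J.toContinuousLinearMap with hX'
  have hmon : ∀ w, X' (monomial (wordType w)) = wordOp T w h := by
    intro w
    set α := wordType w with hα
    have h1 : X' (monomial α) =
        ((√(weight α) : ℝ) : ℂ) • ((√(weight α) : ℝ) : ℂ) • ∑ v ∈ wordsOfType α, wordOp T v h := by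
      change X (J _) = _
      rw [monomial, map_smul, hJ, symVector, map_smul, map_smul, map_sum]
      simp only [intertwiner_fockBasis hX, ← hh]
    -- all summands agree, and there are `1 / weight α` of them
    rw [h1, Finset.sum_congr rfl fun v hv => by
      rw [wordOp_eq_of_wordType_eq hT (mem_wordsOfType.1 hv)], Finset.sum_const, smul_smul,
      ← Complex.ofReal_mul, Real.mul_self_sqrt (weight_pos α).le, ← Nat.cast_smul_eq_nsmul ℂ,
      smul_smul]
    have h2 : ((weight α : ℝ) : ℂ) * ((wordsOfType α).card : ℂ) = 1 := by
      exact_mod_cast weight_mul_card α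
    rw [h2, one_smul]
  refine ⟨X', ?_, ?_, fun k => ext_on_basis (monomialBasis d) fun α => ?_⟩
  · exact (ContinuousLinearMap.opNorm_comp_le _ _).trans
      (mul_le_one₀ hX1 (norm_nonneg _) J.norm_toContinuousLinearMap_le)
  · have hle : ∀ y, X y ∈ (LinearMap.range (X' : DruryArveson d →ₗ[ℂ] H)).topologicalClosure := by
      intro y
      have hy : y ∈ (Submodule.span ℂ (Set.range (fockBasis d))).topologicalClosure :=
        (fockBasis d).dense_span ▸ Submodule.mem_top
      refine map_mem_closure X.continuous hy fun v hv => ?_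
      refine (Submodule.span_le.2 ?_ : _ ≤ (LinearMap.range
        (X' : DruryArveson d →ₗ[ℂ] H)).comap (X : FullFock d →ₗ[ℂ] H)) hv
      rintro _ ⟨w, rfl⟩
      exact ⟨monomial (wordType w), (hmon w).trans (intertwiner_fockBasis hX w).symm⟩
    intro x
    refine closure_minimal ?_ isClosed_closure (hXd x)
    rintro _ ⟨y, rfl⟩
    exact hle y
  · obtain ⟨w, hw⟩ := wordsOfType_nonempty α
    obtain rfl := mem_wordsOfType.1 hw
    have h3 : X' (DruryArveson.mulCoord k (monomial (wordType w))) =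
        T k (X' (monomial (wordType w))) := by
      rw [mulCoord_monomial, ← wordType_cons, hmon, hmon, wordOp_cons_apply]
    rw [monomial, map_smul, map_smul, map_smul, map_smul] at h3
    exact smul_right_injective H (DruryArveson.sqrt_weight_ne_zero _) h3

end Symmetric

end RowShift

end

theorem theoremT (d : ℕ) (hd : 0 < d) {H : Type*} [NormedAddCommGroup H] [InnerProductSpace ℂ H]
    [CompleteSpace H] (T : Fin d → H →L[ℂ] H)
    (hrow : RowShift.IsRowContraction T) (hpure : RowShift.IsPure T)
    (hcyc : RowShift.IsCyclic T) :
    (∃ X : RowShift.FullFock d →L[ℂ] H, ‖X‖ ≤ 1 ∧ DenseRange X ∧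
      ∀ k, X.comp (RowShift.creation k) = (T k).comp X) ∧
    ((∀ j k, T j * T k = T k * T j) →
      ∃ X' : RowShift.DruryArveson d →L[ℂ] H, ‖X'‖ ≤ 1 ∧ DenseRange X' ∧
        ∀ k, X'.comp (RowShift.DruryArveson.mulCoord k) = (T k).comp X') := by
  obtain ⟨X, hX1, hXd, hX⟩ := RowShift.exists_fock_model hrow hpure hcyc
  exact ⟨⟨X, hX1, hXd, hX⟩, fun hT => RowShift.exists_druryArveson_model hT hX1 hXd hX⟩
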